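/- Let $\mathfrak g=(\mathfrak{sl}_2\otimes\mathbb C[t,t^{-1}])\oplus\mathbb C c\oplus\mathbb C d$ be the affine Kac--Moody Lie algebra of type $A_1^{(1)}$, with bracket $[t^k\otimes x,t^l\otimes y]=t^{k+l}\otimes[x,y]+k\,\delta_{k,-l}\,\mathrm{tr}(xy)\,c$, $[d,t^k\otimes x]=k\,t^k\otimes x$, $c$ central, and Cartan subalgebra $\mathfrak h=\mathbb C\alpha^\vee\oplus\mathbb C c\oplus\mathbb C d$, where $\alpha^\vee=1\otimes\mathrm{diag}(1,-1)$. Let $\alpha,\Lambda_0,\delta\in\mathfrak h^*$ be given on $(\alpha^\vee,c,d)$ by $(2,0,0)$, $(0,1,0)$, $(0,0,1)$, and put $\rho=2\Lambda_0+\frac12\alpha$. Let $W\subset GL(\mathfrak h^*)$ be the affine Weyl group, generated by the reflections in the simple roots $\alpha_0=\delta-\alpha$, $\alpha_1=\alpha$ with simple coroots $c-\alpha^\vee$, $\alpha^\vee$, and let $\varepsilon(w)=(-1)^{\ell(w)}$ for $w\in W$, where $\ell$ is the length function. For a dominant integral weight $\Psi$ let $L(\Psi)$ be the irreducible highest weight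 $\mathfrak g$-module with highest weight $\Psi$, and let $P^o(\Psi)$ be the set of its $\delta$-maximal weights, i.e. of those weights $\lambda$ of $L(\Psi)$ such that $\lambda+n\delta$ is not a weight of $L(\Psi)$ for any integer $n>0$. Let $m',m''\geq 1$, $m=m'+m''$, and let $j,j',j''$ be integers with $0\le j'\le m'$, $0\le j''\le m''$, $0\le j\le m$ and $\frac{j-j'-j''}{2}\in\mathbb Z$. Put $$\Lambda=m\Lambda_0+\tfrac j2\alpha,\qquad \Lambda'=m'\Lambda_0+\tfrac{j'}2\alpha,\qquad \Lambda''=m''\Lambda_0+\tfrac{j''}2\alpha .$$ Let $T_\Lambda^{\Lambda',\Lambda''}$ be the set of all $\lambda\in P^o(\Lambda')$ for which there are $v_{\Lambda,\Lambda'',\lambda}\in W$ and $S_{\Lambda,\Lambda'',\lambda}\in\mathbb Z$ (necessarily unique) with $$\lambda+\Lambda''+\rho=v_{\Lambda,\Lambda'',\lambda}(\Lambda+\rho)+S_{\Lambda,\Lambda'',\lambda}\,\delta .$$ Then the maxima $$\mu_\Lambda^{\Lambda',\Lambda''}=\max\{S_{\Lambda,\Lambda'',\lambda}:\lambda\in T_\Lambda^{\Lambda',\Lambda''},\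 \varepsilon(v_{\Lambda,\Lambda'',\lambda})=1\},$$ $$\bar\mu_\Lambda^{\Lambda',\Lambda''}=\max\{S_{\Lambda,\Lambda'',\lambda}:\lambda\in T_\Lambda^{\Lambda',\Lambda''},\ \varepsilon(v_{\Lambda,\Lambda'',\lambda})=-1\}$$ exist, and so do the corresponding maxima $\mu_\Lambda^{\Lambda'',\Lambda'}$ and $\bar\mu_\Lambda^{\Lambda'',\Lambda'}$ with the roles of $\Lambda'$ and $\Lambda''$ exchanged. If $\mu_\Lambda^{\Lambda',\Lambda''}=\bar\mu_\Lambda^{\Lambda',\Lambda''}$, then $\mu_\Lambda^{\Lambda'',\Lambda'}\neq\bar\mu_\Lambda^{\Lambda'',\Lambda'}$. -/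

import Mathlib

/-!
The affine Lie algebra of type `A₁⁽¹⁾`, its Cartan subalgebra, weights and Weyl group,
irreducible highest weight modules, and the combinatorics of tensor product components.
-/

noncomputable section

open scoped TensorProduct

namespace AffineSl2

/-- The finite dimensional Lie algebra `sl₂(ℂ)`. -/
abbrev Sl2 : Type := LieAlgebra.SpecialLinear.sl (Fin 2) ℂ

/-- The element `e` of the standard triple of `sl₂(ℂ)`. -/
def e : Sl2 := ⟨!![0, 1; 0, 0], by
  simp [LieAlgebra.SpecialLinear.sl, LinearMap.mem_ker, Matrix.trace_fin_two]⟩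

/-- The element `h` of the standard triple of `sl₂(ℂ)`, i.e. the simple coroot `α^∨`. -/
def h : Sl2 := ⟨!![1, 0; 0, -1], by
  simp [LieAlgebra.SpecialLinear.sl, LinearMap.mem_ker, Matrix.trace_fin_two]⟩

/-- The normalized invariant form `(x, y) ↦ tr (x y)` on `sl₂(ℂ)`. -/
def form : LinearMap.BilinForm ℂ Sl2 :=
  LinearMap.mk₂ ℂ (fun x y => Matrix.trace (x.1 * y.1))
    (by intros; simp [add_mul]) (by intros; simp)
    (by intros; simp [mul_add]) (by intros; simp)

lemma form_symm (x y : Sl2) : form x y = form y x :=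
  Matrix.trace_mul_comm x.1 y.1

lemma form_isSymm : form.IsSymm := ⟨fun x y => form_symm x y⟩

lemma form_lie (x y z : Sl2) : form ⁅x, y⁆ z = -form y ⁅x, z⁆ := by
  have h1 : Matrix.trace (y.1 * x.1 * z.1) = Matrix.trace (y.1 * (x.1 * z.1)) := by
    rw [mul_assoc]
  have h2 : Matrix.trace (x.1 * y.1 * z.1) = Matrix.trace (y.1 * (z.1 * x.1)) := by
    rw [mul_assoc, Matrix.trace_mul_comm, mul_assoc]
  change Matrix.trace (⁅x.1, y.1⁆ * z.1) = -Matrix.trace (y.1 * ⁅x.1, z.1⁆)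
  rw [Ring.lie_def, Ring.lie_def, sub_mul, mul_sub, Matrix.trace_sub, Matrix.trace_sub, h1, h2]
  ring

lemma form_lieInvariant : form.lieInvariant Sl2 := fun x y z => form_lie x y z

/-- The loop algebra `ℂ[t, t⁻¹] ⊗ sl₂(ℂ)`. -/
def Loop : Type := LieAlgebra.loopAlgebra ℂ ℤ Sl2

instance : LieRing Loop := inferInstanceAs (LieRing (LieAlgebra.loopAlgebra ℂ ℤ Sl2))

instance : LieAlgebra ℂ Loop :=
  inferInstanceAs (LieAlgebra ℂ (LieAlgebra.loopAlgebra ℂ ℤ Sl2))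

/-- The element `tⁿ ⊗ x` of the loop algebra. -/
def mono (n : ℤ) (x : Sl2) : Loop :=
  (AddMonoidAlgebra.single n (1 : ℂ) ⊗ₜ[ℂ] x : LieAlgebra.loopAlgebra ℂ ℤ Sl2)

/-- The derivation `t d/dt` of the Laurent polynomials, `tⁿ ↦ n tⁿ`. -/
def eulerLaurent : AddMonoidAlgebra ℂ ℤ →ₗ[ℂ] AddMonoidAlgebra ℂ ℤ :=
  (AddMonoidAlgebra.basis ℤ ℂ).constr ℂ
    fun n => (n : ℂ) • AddMonoidAlgebra.single n (1 : ℂ)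

/-- The derivation `t d/dt` of the loop algebra, `tⁿ ⊗ x ↦ n tⁿ ⊗ x`. -/
def euler : Loop →ₗ[ℂ] Loop :=
  (eulerLaurent.rTensor Sl2 :
    LieAlgebra.loopAlgebra ℂ ℤ Sl2 →ₗ[ℂ] LieAlgebra.loopAlgebra ℂ ℤ Sl2)

/-- The 2-cocycle `ω (t^m ⊗ x, t^n ⊗ y) = m δ_{m,-n} tr (x y)` of the loop algebra. -/
def cocycle : LinearMap.BilinForm ℂ Loop :=
  ((LieAlgebra.LoopAlgebra.residuePairing ℂ ℤ Sl2 form).flip :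
    LinearMap.BilinForm ℂ (LieAlgebra.loopAlgebra ℂ ℤ Sl2))

lemma euler_mono (n : ℤ) (x : Sl2) : euler (mono n x) = (n : ℂ) • mono n x := by
  have h1 : eulerLaurent (AddMonoidAlgebra.single n (1 : ℂ)) =
      (n : ℂ) • AddMonoidAlgebra.single n (1 : ℂ) := by
    have := (AddMonoidAlgebra.basis ℤ ℂ).constr_basis ℂ
      (fun n => (n : ℂ) • AddMonoidAlgebra.single n (1 : ℂ)) n
    simpa [eulerLaurent] using this
  change eulerLaurent (AddMonoidAlgebra.single n (1 : ℂ)) ⊗ₜ[ℂ] x =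
    (n : ℂ) • (AddMonoidAlgebra.single n (1 : ℂ) ⊗ₜ[ℂ] x : LieAlgebra.loopAlgebra ℂ ℤ Sl2)
  rw [h1, TensorProduct.smul_tmul']

lemma mono_lie (m n : ℤ) (x y : Sl2) : ⁅mono m x, mono n y⁆ = mono (m + n) ⁅x, y⁆ := by
  change (AddMonoidAlgebra.single m (1 : ℂ) * AddMonoidAlgebra.single n (1 : ℂ)) ⊗ₜ[ℂ] ⁅x, y⁆ =
    (AddMonoidAlgebra.single (m + n) (1 : ℂ) ⊗ₜ[ℂ] ⁅x, y⁆ : LieAlgebra.loopAlgebra ℂ ℤ Sl2)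
  rw [AddMonoidAlgebra.single_mul_single, one_mul]

lemma cocycle_mono (m n : ℤ) (x y : Sl2) :
    cocycle (mono m x) (mono n y) = if m = -n then (m : ℂ) * form x y else 0 := by
  have : cocycle (mono m x) (mono n y) =
      m • form ((Finsupp.single n y : ℤ →₀ Sl2) (-m)) x := by
    change LieAlgebra.LoopAlgebra.residuePairing ℂ ℤ Sl2 form
      (AddMonoidAlgebra.single n (1 : ℂ) ⊗ₜ[ℂ] y)
      (AddMonoidAlgebra.single m (1 : ℂ) ⊗ₜ[ℂ] x) = _
    rw [LieAlgebra.LoopAlgebra.residuePairing_apply_apply,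
      LieAlgebra.LoopAlgebra.toFinsupp_single_tmul, LieAlgebra.LoopAlgebra.toFinsupp_single_tmul,
      Finsupp.sum_single_index (by simp)]
  rw [this]
  by_cases hmn : m = -n
  · subst hmn
    simp [form_symm x y]
  · rw [if_neg hmn, Finsupp.single_eq_of_ne (by omega)]
    simp

/-- Additive induction on the loop algebra. -/
lemma loop_induction {p : Loop → Prop} (x : Loop) (h0 : p 0)
    (hm : ∀ n x, p (mono n x)) (ha : ∀ x y, p x → p y → p (x + y)) : p x := by
  have key : ∀ f : ℤ →₀ Sl2, p ((LieAlgebra.LoopAlgebra.toFinsupp ℂ ℤ Sl2).symm f) := by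
    intro f
    induction f using Finsupp.induction_linear with
    | zero => rw [map_zero]; exact h0
    | add f g hf hg => rw [map_add]; exact ha _ _ hf hg
    | single n a => rw [LieAlgebra.LoopAlgebra.toFinsupp_symm_single]; exact hm n a
  have hx := key (LieAlgebra.LoopAlgebra.toFinsupp ℂ ℤ Sl2 x)
  have hs := (LieAlgebra.LoopAlgebra.toFinsupp ℂ ℤ Sl2).symm_apply_apply x
  exact hs ▸ hx

lemma euler_lie (x y : Loop) : euler ⁅x, y⁆ = ⁅euler x, y⁆ + ⁅x, euler y⁆ := by
  induction x using loop_induction with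
  | h0 => simp
  | ha x x' hx hx' => simp only [add_lie, map_add, hx, hx']; abel
  | hm m x =>
    induction y using loop_induction with
    | h0 => simp
    | ha y y' hy hy' => simp only [lie_add, map_add, hy, hy']; abel
    | hm n y =>
      simp only [euler_mono, mono_lie, smul_lie, lie_smul]
      push_cast
      rw [add_smul]

lemma cocycle_self (x : Loop) : cocycle x x = 0 := by
  have := (LieAlgebra.LoopAlgebra.twoCochainOfBilinear ℂ ℤ Sl2 form form_isSymm).2
  rw [LieModule.Cohomology.mem_twoCochain_iff] at this
  exact this x

lemma cocycle_swap (x y : Loop) : cocycle x y = -cocycle y x := by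
  have := cocycle_self (x + y)
  simp only [map_add, LinearMap.add_apply, cocycle_self] at this
  linear_combination this

lemma cocycle_euler (x y : Loop) : cocycle (euler x) y = -cocycle x (euler y) := by
  induction x using loop_induction with
  | h0 => simp
  | ha x x' hx hx' => simp only [map_add, LinearMap.add_apply, hx, hx']; ring
  | hm m x =>
    induction y using loop_induction with
    | h0 => simp
    | ha y y' hy hy' => simp only [map_add, hy, hy']; ring
    | hm n y =>
      simp only [euler_mono, map_smul, LinearMap.smul_apply, cocycle_mono, smul_eq_mul]
      split_ifs with hmn
      · subst hmn; push_cast; ring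
      · simp

lemma cocycle_lie (x y z : Loop) :
    cocycle x ⁅y, z⁆ = cocycle ⁅x, y⁆ z + cocycle y ⁅x, z⁆ := by
  induction x using loop_induction with
  | h0 => simp
  | ha x x' hx hx' =>
    simp only [add_lie, map_add, LinearMap.add_apply, hx, hx']; ring
  | hm m x =>
    induction y using loop_induction with
    | h0 => simp
    | ha y y' hy hy' =>
      simp only [add_lie, lie_add, map_add, LinearMap.add_apply, hy, hy']; ring
    | hm n y =>
      induction z using loop_induction with
      | h0 => simp
      | ha z z' hz hz' => simp only [lie_add, map_add, hz, hz']; ring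
      | hm k z =>
        simp only [mono_lie, cocycle_mono]
        have e1 : form x ⁅y, z⁆ = form ⁅x, y⁆ z := by
          have := form_lie y x z
          rw [← lie_skew y x, map_neg, LinearMap.neg_apply] at this
          linear_combination this
        have e2 : form y ⁅x, z⁆ = -form ⁅x, y⁆ z := by
          linear_combination form_lie x y z
        rw [e1, e2]
        by_cases hs : m + n + k = 0
        · rw [if_pos (by omega), if_pos (by omega), if_pos (by omega)]
          push_cast; ring
        · rw [if_neg (by omega), if_neg (by omega), if_neg (by omega)]
          simp

/-- The affine Kac-Moody algebra `(ℂ[t, t⁻¹] ⊗ sl₂) ⊕ ℂ c ⊕ ℂ d` of type `A₁⁽¹⁾`.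
The triple `(x, a, b)` stands for `x + a c + b d`. -/
def Affine : Type := Loop × ℂ × ℂ

namespace Affine

instance : AddCommGroup Affine := inferInstanceAs (AddCommGroup (Loop × ℂ × ℂ))

instance : Module ℂ Affine := inferInstanceAs (Module ℂ (Loop × ℂ × ℂ))

/-- `[x + a c + b d, x' + a' c + b' d] = [x, x'] + b t(dx'/dt) - b' t(dx/dt) + ω (x, x') c`. -/
instance : Bracket Affine Affine where
  bracket u v := (⁅u.1, v.1⁆ + (u.2.2 • euler v.1 - v.2.2 • euler u.1), cocycle u.1 v.1, 0)

lemma bracket_def (u v : Affine) : ⁅u, v⁆ =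
    (⁅u.1, v.1⁆ + (u.2.2 • euler v.1 - v.2.2 • euler u.1), cocycle u.1 v.1, 0) := rfl

@[ext] lemma ext {u v : Affine} (h1 : u.1 = v.1) (h2 : u.2.1 = v.2.1) (h3 : u.2.2 = v.2.2) :
    u = v := Prod.ext h1 (Prod.ext h2 h3)

@[simp] lemma add_fst (u v : Affine) : (u + v).1 = u.1 + v.1 := rfl
@[simp] lemma add_snd_fst (u v : Affine) : (u + v).2.1 = u.2.1 + v.2.1 := rfl
@[simp] lemma add_snd_snd (u v : Affine) : (u + v).2.2 = u.2.2 + v.2.2 := rfl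
@[simp] lemma zero_fst : (0 : Affine).1 = 0 := rfl
@[simp] lemma zero_snd_fst : (0 : Affine).2.1 = 0 := rfl
@[simp] lemma zero_snd_snd : (0 : Affine).2.2 = 0 := rfl
@[simp] lemma smul_fst (a : ℂ) (u : Affine) : (a • u).1 = a • u.1 := rfl
@[simp] lemma smul_snd_fst (a : ℂ) (u : Affine) : (a • u).2.1 = a * u.2.1 := rfl
@[simp] lemma smul_snd_snd (a : ℂ) (u : Affine) : (a • u).2.2 = a * u.2.2 := rfl
@[simp] lemma lie_fst (u v : Affine) :
    ⁅u, v⁆.1 = ⁅u.1, v.1⁆ + (u.2.2 • euler v.1 - v.2.2 • euler u.1) := rfl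
@[simp] lemma lie_snd_fst (u v : Affine) : ⁅u, v⁆.2.1 = cocycle u.1 v.1 := rfl
@[simp] lemma lie_snd_snd (u v : Affine) : ⁅u, v⁆.2.2 = 0 := rfl

instance : LieRing Affine where
  add_lie u v w := by
    ext1
    · simp only [lie_fst, add_fst, add_snd_snd, add_lie, map_add, add_smul, smul_add]; abel
    · simp
    · simp
  lie_add u v w := by
    ext1
    · simp only [lie_fst, add_fst, add_snd_snd, lie_add, map_add, add_smul, smul_add]; abel
    · simp
    · simp
  lie_self u := by
    ext1
    · simp
    · simp [cocycle_self]
    · simp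
  leibniz_lie u v w := by
    ext1
    · simp only [lie_fst, add_fst, lie_snd_snd, lie_add, add_lie, lie_sub, sub_lie, map_add,
        map_sub, map_smul, lie_smul, smul_lie, euler_lie, smul_add, smul_sub, zero_smul,
        smul_comm w.2.2 v.2.2, smul_comm w.2.2 u.2.2, smul_comm v.2.2 u.2.2]
      rw [leibniz_lie u.1 v.1 w.1, ← lie_skew v.1 (euler u.1)]
      simp only [smul_neg]
      abel
    · simp only [lie_fst, add_snd_fst, lie_snd_fst, map_add, map_sub, map_smul,
        LinearMap.add_apply, LinearMap.sub_apply, LinearMap.smul_apply, smul_eq_mul]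
      rw [cocycle_lie u.1 v.1 w.1, cocycle_euler v.1 w.1, cocycle_euler u.1 w.1,
        cocycle_swap v.1 (euler u.1), cocycle_euler u.1 v.1]
      ring
    · simp

instance : LieAlgebra ℂ Affine where
  lie_smul a u v := by
    ext1
    · simp only [lie_fst, smul_fst, smul_snd_snd, lie_smul, map_smul, smul_add, smul_sub,
        mul_smul, smul_comm u.2.2 a]
    · simp
    · simp

/-- The inclusion of the loop algebra (as a vector space), `x ↦ x + 0 c + 0 d`. -/
def ofLoop (x : Loop) : Affine := (x, 0, 0)

end Affine

/-- The standard Cartan subalgebra `𝔥 = ℂ α^∨ ⊕ ℂ c ⊕ ℂ d`, where `α^∨ = 1 ⊗ h`.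
The triple `(p, q, r)` stands for `p α^∨ + q c + r d`. -/
abbrev Cartan : Type := ℂ × ℂ × ℂ

/-- The inclusion of `𝔥` into the affine Lie algebra. -/
def Cartan.toAffine (k : Cartan) : Affine := (k.1 • mono 0 h, k.2.1, k.2.2)

/-- The dual `𝔥^*` of the Cartan subalgebra. -/
abbrev Weight : Type := Module.Dual ℂ Cartan

/-- The simple root `α` of `sl₂`: it is `2` on `α^∨` and vanishes on `c` and `d`. -/
def α : Weight := (2 : ℂ) • LinearMap.fst ℂ ℂ (ℂ × ℂ)

/-- The fundamental weight `Λ₀`: it is `1` on `c` and vanishes on `α^∨` and `d`. -/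
def Λ₀ : Weight := LinearMap.fst ℂ ℂ ℂ ∘ₗ LinearMap.snd ℂ ℂ (ℂ × ℂ)

/-- The smallest positive imaginary root `δ`: it is `1` on `d` and vanishes on `α^∨` and `c`. -/
def δ : Weight := LinearMap.snd ℂ ℂ ℂ ∘ₗ LinearMap.snd ℂ ℂ (ℂ × ℂ)

/-- The weight `ρ = 2 Λ₀ + α / 2`, which takes the value `1` on both simple coroots. -/
def ρ : Weight := (2 : ℂ) • Λ₀ + (1 / 2 : ℂ) • α

/-- The simple roots `α₀ = δ - α` and `α₁ = α`. -/
def simpleRoot : Fin 2 → Weight := ![δ - α, α]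

/-- The simple coroots `α₀^∨ = c - α^∨` and `α₁^∨ = α^∨`. -/
def simpleCoroot : Fin 2 → Cartan := ![(-1, 1, 0), (1, 0, 0)]

lemma simpleRoot_simpleCoroot (i : Fin 2) : simpleRoot i (simpleCoroot i) = 2 := by
  fin_cases i <;> simp [simpleRoot, simpleCoroot, α, δ]

/-- The simple reflection `s_i : λ ↦ λ - λ(α_i^∨) α_i` of `𝔥^*`. -/
def simpleReflection (i : Fin 2) : Weight ≃ₗ[ℂ] Weight :=
  Module.reflection (f := Module.Dual.eval ℂ Cartan (simpleCoroot i))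
    (x := simpleRoot i) (simpleRoot_simpleCoroot i)

/-- The affine Weyl group, generated by the simple reflections. -/
def weylGroup : Subgroup (Weight ≃ₗ[ℂ] Weight) :=
  Subgroup.closure (Set.range simpleReflection)

/-- The length of an element of the Weyl group: the smallest length of a word in the simple
reflections which represents it. -/
def length (w : weylGroup) : ℕ :=
  sInf {n | ∃ l : List (Fin 2), l.length = n ∧ (l.map simpleReflection).prod = w}

/-- The sign `ε(w) = (-1)^{ℓ(w)}`. -/
def sign (w : weylGroup) : ℤ := (-1) ^ length w

/-- The weight `m Λ₀ + (j / 2) α`. It is dominant integral if and only if `m` and `j` are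
nonnegative integers with `j ≤ m`. -/
def wt (m j : ℕ) : Weight := (m : ℂ) • Λ₀ + ((j : ℂ) / 2) • α

section Module

variable (V : Type*) [AddCommGroup V] [Module ℂ V] [LieRingModule Affine V]

/-- `V` is an irreducible highest weight module with highest weight `Λ`, that is, a model of
`L(Λ)`: it is irreducible and has a nonzero vector `v` of weight `Λ` which is annihilated by
`𝔫₊ = ℂ (1 ⊗ e) ⊕ ⨁_{n > 0} tⁿ ⊗ sl₂`. -/
structure IsIrreducibleHighestWeight (Λ : Weight) : Prop where
  irreducible : LieModule.IsIrreducible ℂ Affine V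
  exists_highestWeightVector : ∃ v : V, v ≠ 0 ∧
    (∀ k : Cartan, ⁅k.toAffine, v⁆ = Λ k • v) ∧
    ⁅Affine.ofLoop (mono 0 e), v⁆ = 0 ∧
    ∀ n : ℤ, 0 < n → ∀ x : Sl2, ⁅Affine.ofLoop (mono n x), v⁆ = 0

/-- The set `P(V)` of weights of `V`: those `μ` whose weight space is nonzero. -/
def weights : Set Weight :=
  {μ | ∃ v : V, v ≠ 0 ∧ ∀ k : Cartan, ⁅k.toAffine, v⁆ = μ k • v}

/-- The set `P^o(V)` of `δ`-maximal weights of `V`. -/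
def maximalWeights : Set Weight :=
  {μ | μ ∈ weights V ∧ ∀ n : ℕ, 0 < n → μ + (n : ℂ) • δ ∉ weights V}

/-- For `V = L(Λ')` and a sign `s`, the set of all `S_{Λ,Λ'',μ}` such that `μ ∈ T_Λ^{Λ',Λ''}` and
`ε(v_{Λ,Λ'',μ}) = s`. Here `μ ∈ T_Λ^{Λ',Λ''}` means that `μ` is a `δ`-maximal weight of `L(Λ')`
with `μ + Λ'' + ρ = v (Λ + ρ) + S δ` for some `v` in the Weyl group and some integer `S`; these
`v = v_{Λ,Λ'',μ}` and `S = S_{Λ,Λ'',μ}` are uniquely determined by `Λ`, `Λ''` and `μ` when `Λ` is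
dominant integral. -/
def shifts (Λ Λ'' : Weight) (s : ℤ) : Set ℤ :=
  {S : ℤ | ∃ μ ∈ maximalWeights V, ∃ v : weylGroup, sign v = s ∧
    μ + Λ'' + ρ = v.1 (Λ + ρ) + (S : ℂ) • δ}

end Module

end AffineSl2

end

/-! For each k ≡ j mod 2 the module L(mΛ₀ + (j/2)α) has exactly one δ-maximal weight of the form mΛ₀
+ (k/2)α + N(k)δ, and there are no others (`exists_isDepthFunction`). Integrability makes the weight
set stable under the simple reflections, so N(-k) = N(k) and N(2m-k) = N(k) - m + k. Root strings
through the highest weight give N = 0 on [0, j] and N(k) = (j-k)/2 on [j, m]. Hence N(k) is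
non-increasing in |k|, strictly as soon as the larger |k| exceeds j, and 2N(k) + k is non-increasing
in |k-m|, strictly as soon as the larger |k-m| exceeds m-j (`le_of_abs_le`,
`two_mul_add_le_of_abs_le`).

A Weyl group element is recorded by its sign s and a translation parameter r. Let N belong to Λ',
and put M = m'+m''+2, J = j+1, J'' = j''+1. Comparing coordinates in λ + Λ'' + ρ = v(Λ + ρ) + Sδ
gives S = N(k) + sJr + Mr² with k = sJ + 2Mr - J'', and every r occurs (`shifts_eq`). In r this
rises weakly up to 0, and falls weakly from 0 on if s = 1, from 1 on if s = -1. So the maximum for s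
= 1 is at r = 0, and for s = -1 it is at r = 0 or r = 1.

If the two maxima agree, strict monotonicity fails for one of the pairs, which forces J + J'' ≤ j'
or 2M - J - J'' ≤ 2m' - j' (`le_or_le_of_maxima_eq`). These inequalities contradict the ones
obtained by exchanging Λ' and Λ''. -/

noncomputable section

namespace AffineSl2

open AffineSl2.Affine

/-! ### Chevalley generators of the affine algebra -/

/-- The element `f` of the standard triple of `sl₂(ℂ)`. -/
def f : Sl2 := ⟨!![0, 0; 1, 0], by
  simp [LieAlgebra.SpecialLinear.sl, LinearMap.mem_ker, Matrix.trace_fin_two]⟩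

lemma lie_e_f : ⁅e, f⁆ = h := by
  apply Subtype.ext
  change ⁅e.1, f.1⁆ = h.1
  rw [Ring.lie_def]
  simp [e, f, h]

lemma lie_h_e : ⁅h, e⁆ = (2 : ℂ) • e := by
  apply Subtype.ext
  change ⁅h.1, e.1⁆ = (2 : ℂ) • e.1
  rw [Ring.lie_def]
  ext i j; fin_cases i <;> fin_cases j <;> norm_num [e, h]

lemma lie_h_f : ⁅h, f⁆ = (-2 : ℂ) • f := by
  apply Subtype.ext
  change ⁅h.1, f.1⁆ = (-2 : ℂ) • f.1
  rw [Ring.lie_def]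
  ext i j; fin_cases i <;> fin_cases j <;> norm_num [f, h]

lemma form_e_f : form e f = 1 := by
  change Matrix.trace (e.1 * f.1) = 1
  simp [e, f, Matrix.trace_fin_two]

lemma sl2_eq (x : Sl2) : x = x.1 0 1 • e + x.1 1 0 • f + x.1 0 0 • h := by
  apply Subtype.ext
  have hx : x.1 1 1 = -x.1 0 0 := by
    have := x.2
    have h2 : Matrix.trace x.1 = 0 := this
    rw [Matrix.trace_fin_two] at h2
    linear_combination h2
  change x.1 = x.1 0 1 • e.1 + x.1 1 0 • f.1 + x.1 0 0 • h.1
  ext i j; fin_cases i <;> fin_cases j <;> simp [e, f, h, hx]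

@[simp] lemma ofLoop_fst (x : Loop) : (ofLoop x).1 = x := rfl
@[simp] lemma ofLoop_snd_fst (x : Loop) : (ofLoop x).2.1 = 0 := rfl
@[simp] lemma ofLoop_snd_snd (x : Loop) : (ofLoop x).2.2 = 0 := rfl
@[simp] lemma toAffine_fst (k : Cartan) : k.toAffine.1 = k.1 • mono 0 h := rfl
@[simp] lemma toAffine_snd_fst (k : Cartan) : k.toAffine.2.1 = k.2.1 := rfl
@[simp] lemma toAffine_snd_snd (k : Cartan) : k.toAffine.2.2 = k.2.2 := rfl

/-- The map `x ↦ tⁿ ⊗ x`, as a linear map to the affine Lie algebra. -/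
def loopMono (n : ℤ) : Sl2 →ₗ[ℂ] Affine where
  toFun x := ofLoop (mono n x)
  map_add' x y := by
    ext1
    · exact TensorProduct.tmul_add (AddMonoidAlgebra.single n (1 : ℂ)) x y
    · simp
    · simp
  map_smul' a x := by
    ext1
    · exact TensorProduct.tmul_smul a (AddMonoidAlgebra.single n (1 : ℂ)) x
    · simp
    · simp

lemma loopMono_apply (n : ℤ) (x : Sl2) : loopMono n x = ofLoop (mono n x) := rfl

lemma lie_loopMono (a b : ℤ) (x y : Sl2) : ⁅loopMono a x, loopMono b y⁆ =
    loopMono (a + b) ⁅x, y⁆ +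
      Cartan.toAffine (0, if a = -b then (a : ℂ) * form x y else 0, 0) := by
  ext1
  · simp [loopMono_apply, mono_lie]
  · simp [loopMono_apply, cocycle_mono]
  · simp [loopMono_apply]

lemma lie_toAffine_loopMono (k : Cartan) (n : ℤ) (x : Sl2) :
    ⁅k.toAffine, loopMono n x⁆ = loopMono n (k.1 • ⁅h, x⁆ + (k.2.2 * n) • x) := by
  rw [map_add, map_smul, map_smul]
  ext1
  · simp [loopMono_apply, mono_lie, euler_mono, mul_smul]
  · simp [loopMono_apply, cocycle_mono]
  · simp [loopMono_apply]

/-- The inclusion of the Cartan subalgebra as a linear map. -/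
def cartanIncl : Cartan →ₗ[ℂ] Affine where
  toFun := Cartan.toAffine
  map_add' k l := by
    ext1 <;> simp [add_smul]
  map_smul' a k := by
    ext1 <;> simp [mul_smul]

/-- The Chevalley generators `e₀ = t ⊗ f` and `e₁ = 1 ⊗ e`. -/
def chevE : Fin 2 → Affine := ![loopMono 1 f, loopMono 0 e]

/-- The Chevalley generators `f₀ = t⁻¹ ⊗ e` and `f₁ = 1 ⊗ f`. -/
def chevF : Fin 2 → Affine := ![loopMono (-1) e, loopMono 0 f]

lemma form_f_e : form f e = 1 := by rw [form_symm, form_e_f]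

lemma lie_chevE_chevF (i : Fin 2) :
    ⁅chevE i, chevF i⁆ = (simpleCoroot i).toAffine := by
  fin_cases i
  · simp only [chevE, chevF, simpleCoroot, Fin.zero_eta, Matrix.cons_val_zero, lie_loopMono,
      form_f_e]
    rw [← lie_skew f e, lie_e_f]
    ext1 <;> simp [loopMono_apply]
    exact TensorProduct.tmul_neg (AddMonoidAlgebra.single (0 : ℤ) (1 : ℂ)) h
  · simp only [chevE, chevF, simpleCoroot, Fin.mk_one, Matrix.cons_val_one, Matrix.cons_val_zero, lie_loopMono,
      form_e_f, lie_e_f]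
    ext1 <;> simp [loopMono_apply]

lemma toAffine_zero : Cartan.toAffine (0, 0, 0) = 0 := cartanIncl.map_zero

lemma lie_chevE_chevF_of_ne {i j : Fin 2} (hij : i ≠ j) : ⁅chevE i, chevF j⁆ = 0 := by
  fin_cases i <;> fin_cases j <;> simp [chevE, chevF, lie_loopMono, toAffine_zero] at hij ⊢

lemma lie_toAffine_chevE (k : Cartan) (i : Fin 2) :
    ⁅k.toAffine, chevE i⁆ = simpleRoot i k • chevE i := by
  fin_cases i
  · simp only [chevE, simpleRoot, Fin.zero_eta, Matrix.cons_val_zero, lie_toAffine_loopMono,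
      lie_h_f]
    rw [← map_smul, smul_smul, ← add_smul]
    congr 2
    simp [δ, α]; ring
  · simp only [chevE, simpleRoot, Fin.mk_one, Matrix.cons_val_one, Matrix.cons_val_zero, lie_toAffine_loopMono,
      lie_h_e]
    rw [← map_smul, smul_smul, ← add_smul]
    congr 2
    simp [α]; ring

lemma lie_toAffine_chevF (k : Cartan) (i : Fin 2) :
    ⁅k.toAffine, chevF i⁆ = -(simpleRoot i k • chevF i) := by
  rw [← neg_smul]
  fin_cases i
  · simp only [chevF, simpleRoot, Fin.zero_eta, Matrix.cons_val_zero, lie_toAffine_loopMono,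
      lie_h_e]
    rw [← map_smul, smul_smul, ← add_smul]
    congr 2
    simp [δ, α]; ring
  · simp only [chevF, simpleRoot, Fin.mk_one, Matrix.cons_val_one, Matrix.cons_val_zero, lie_toAffine_loopMono,
      lie_h_f]
    rw [← map_smul, smul_smul, ← add_smul]
    congr 2
    simp [α]; ring

/-- The affine Lie algebra is generated by the Chevalley generators and the Cartan subalgebra. -/
lemma eq_top_of_generators_mem (S : LieSubalgebra ℂ Affine) (hE : ∀ i, chevE i ∈ S)
    (hF : ∀ i, chevF i ∈ S) (hk : ∀ k : Cartan, k.toAffine ∈ S) : S = ⊤ := by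
  -- The central term of the bracket lies in the Cartan subalgebra, so it can be subtracted inside
  -- `S`.
  have hlie (a b : ℤ) (x y : Sl2) (hx : loopMono a x ∈ S) (hy : loopMono b y ∈ S) :
      loopMono (a + b) ⁅x, y⁆ ∈ S := by
    have h1 := S.lie_mem hx hy
    rw [lie_loopMono] at h1
    exact (S.add_mem_iff_left (hk _)).1 h1
  have hspan (n : ℤ) (h1 : loopMono n e ∈ S) (h2 : loopMono n f ∈ S) (h3 : loopMono n h ∈ S)
      (x : Sl2) : loopMono n x ∈ S := by
    rw [sl2_eq x, map_add, map_add, map_smul, map_smul, map_smul]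
    exact S.add_mem (S.add_mem (S.smul_mem _ h1) (S.smul_mem _ h2)) (S.smul_mem _ h3)
  -- Since sl₂ is perfect, degrees `a` and `b` together produce all of degree `a + b`; degrees 0, 1
  -- and -1 then suffice.
  have hstep (a b : ℤ) (ha : ∀ x, loopMono a x ∈ S) (hb : ∀ x, loopMono b x ∈ S) (x : Sl2) :
      loopMono (a + b) x ∈ S := by
    apply hspan
    · have h1 := hlie a b h e (ha _) (hb _)
      rw [lie_h_e, map_smul] at h1
      simpa [smul_smul] using S.smul_mem (1 / 2 : ℂ) h1
    · have h1 := hlie a b h f (ha _) (hb _)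
      rw [lie_h_f, map_smul] at h1
      simpa [smul_smul] using S.smul_mem (-1 / 2 : ℂ) h1
    · rw [← lie_e_f]
      exact hlie a b e f (ha _) (hb _)
  have he0 : loopMono 0 e ∈ S := hE 1
  have hf0 : loopMono 0 f ∈ S := hF 1
  have hf1 : loopMono 1 f ∈ S := hE 0
  have he1 : loopMono (-1) e ∈ S := hF 0
  have h0 : ∀ x, loopMono 0 x ∈ S := hspan 0 he0 hf0 (by
    rw [← lie_e_f]
    simpa using hlie 0 0 e f he0 hf0)
  have hh1 : loopMono 1 h ∈ S := by
    rw [← lie_e_f]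
    simpa using hlie 0 1 e f he0 hf1
  have hp : ∀ x, loopMono 1 x ∈ S := hspan 1 (by
    have h1 := hlie 1 0 h e hh1 he0
    rw [lie_h_e, map_smul] at h1
    simpa [smul_smul] using S.smul_mem (1 / 2 : ℂ) h1) hf1 hh1
  have hh2 : loopMono (-1) h ∈ S := by
    rw [← lie_e_f]
    simpa using hlie (-1) 0 e f he1 hf0
  have hm : ∀ x, loopMono (-1) x ∈ S := hspan (-1) he1 (by
    have h1 := hlie (-1) 0 h f hh2 hf0
    rw [lie_h_f, map_smul] at h1
    simpa [smul_smul] using S.smul_mem (-1 / 2 : ℂ) h1) hh2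
  have hall (n : ℤ) : ∀ x, loopMono n x ∈ S := by
    induction n using Int.induction_on with
    | zero => exact h0
    | succ n ih => exact hstep n 1 ih hp
    | pred n ih => exact hstep (-n) (-1) ih hm
  rw [eq_top_iff]
  intro u _
  have hu : u = ofLoop u.1 + Cartan.toAffine (0, u.2.1, u.2.2) := by
    ext1 <;> simp
  rw [hu]
  refine S.add_mem ?_ (hk _)
  generalize u.1 = x
  induction x using loop_induction with
  | h0 => exact S.zero_mem
  | hm n x => exact hall n x
  | ha x y hx hy =>
    have : ofLoop (x + y) = ofLoop x + ofLoop y := by ext1 <;> simp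
    rw [this]
    exact S.add_mem hx hy

/-! ### Words in the lowering operators and the support of a highest weight module -/

section Representation

variable {V : Type*} [AddCommGroup V] [Module ℂ V] [LieRingModule Affine V]

/-- `v` is a (possibly zero) vector of weight `μ`. -/
def IsWeightVector (μ : Weight) (v : V) : Prop := ∀ k : Cartan, ⁅k.toAffine, v⁆ = μ k • v

/-- The vector obtained from `w` by applying a word in the lowering operators. -/
def word (w : V) : List (Fin 2) → V
  | [] => w
  | i :: l => ⁅chevF i, word w l⁆

lemma mem_span_word (w : V) (l : List (Fin 2)) :
    word w l ∈ Submodule.span ℂ (Set.range (word w)) :=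
  Submodule.subset_span ⟨l, rfl⟩

variable [LieModule ℂ Affine V]

lemma IsWeightVector.chevF {μ : Weight} {v : V} (hv : IsWeightVector μ v) (i : Fin 2) :
    IsWeightVector (μ - simpleRoot i) ⁅chevF i, v⁆ := by
  intro k
  rw [leibniz_lie, lie_toAffine_chevF, hv k, lie_smul, neg_lie, smul_lie, LinearMap.sub_apply,
    sub_smul]
  abel

lemma IsWeightVector.chevE {μ : Weight} {v : V} (hv : IsWeightVector μ v) (i : Fin 2) :
    IsWeightVector (μ + simpleRoot i) ⁅chevE i, v⁆ := by
  intro k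
  rw [leibniz_lie, lie_toAffine_chevE, hv k, lie_smul, smul_lie, LinearMap.add_apply, add_smul]
  abel

lemma isWeightVector_word {μ : Weight} {w : V} (hw : IsWeightVector μ w) (l : List (Fin 2)) :
    IsWeightVector (μ - ((l.count 0 : ℂ) • simpleRoot 0 + (l.count 1 : ℂ) • simpleRoot 1))
      (word w l) := by
  induction l with
  | nil => simpa [word] using hw
  | cons i l ih =>
    change IsWeightVector _ ⁅chevF i, word w l⁆
    convert ih.chevF i using 1
    fin_cases i
    · simp only [Fin.zero_eta, List.count_cons_self, List.count_cons_of_ne (zero_ne_one)]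
      push_cast
      rw [add_smul, one_smul]; abel
    · simp only [Fin.mk_one, List.count_cons_self, List.count_cons_of_ne (one_ne_zero)]
      push_cast
      rw [add_smul, one_smul]; abel

/-- The Lie subalgebra of elements preserving a subspace of a module. -/
def stabilizer (S : Submodule ℂ V) : LieSubalgebra ℂ Affine where
  carrier := {x | ∀ v ∈ S, ⁅x, v⁆ ∈ S}
  add_mem' hx hy v hv := by rw [add_lie]; exact S.add_mem (hx v hv) (hy v hv)
  zero_mem' v _ := by rw [zero_lie]; exact S.zero_mem
  smul_mem' a x hx v hv := by rw [smul_lie]; exact S.smul_mem a (hx v hv)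
  lie_mem' hx hy v hv := by
    rw [lie_lie]; exact S.sub_mem (hx _ (hy v hv)) (hy _ (hx v hv))

/-- In an irreducible module a nonzero subspace which is stable under the Chevalley generators
and the Cartan subalgebra is everything. -/
lemma eq_top_of_stable (hV : LieModule.IsIrreducible ℂ Affine V) (S : Submodule ℂ V)
    (hE : ∀ i, ∀ v ∈ S, ⁅chevE i, v⁆ ∈ S) (hF : ∀ i, ∀ v ∈ S, ⁅chevF i, v⁆ ∈ S)
    (hk : ∀ k : Cartan, ∀ v ∈ S, ⁅k.toAffine, v⁆ ∈ S) {w : V} (hw : w ∈ S) (hw0 : w ≠ 0) :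
    S = ⊤ := by
  have hst : stabilizer S = ⊤ := eq_top_of_generators_mem _ hE hF hk
  let N : LieSubmodule ℂ Affine V :=
    { S with lie_mem := fun {x v} hv => (hst ▸ LieSubalgebra.mem_top x : x ∈ stabilizer S) v hv }
  have hN : N = ⊤ := by
    refine (IsSimpleOrder.eq_bot_or_eq_top N).resolve_left fun hb => hw0 ?_
    have : w ∈ N := hw
    rwa [hb, LieSubmodule.mem_bot] at this
  rw [eq_top_iff]
  intro v _
  have : v ∈ N := hN ▸ LieSubmodule.mem_top v
  exact this

/-- A subspace is stable under an element of the Lie algebra if a spanning set is. -/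
lemma lie_mem_span {s : Set V} {S : Submodule ℂ V} (x : Affine) (hx : ∀ v ∈ s, ⁅x, v⁆ ∈ S) :
    ∀ v ∈ Submodule.span ℂ s, ⁅x, v⁆ ∈ S := by
  intro v hv
  induction hv using Submodule.span_induction with
  | mem v hv => exact hx v hv
  | zero => rw [lie_zero]; exact S.zero_mem
  | add u v _ _ hu hv => rw [lie_add]; exact S.add_mem hu hv
  | smul a v _ hv => rw [lie_smul]; exact S.smul_mem a hv

/-- A singular vector of an irreducible module generates it under the lowering operators. -/
lemma span_word_eq_top (hV : LieModule.IsIrreducible ℂ Affine V) {μ : Weight} {w : V}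
    (hw0 : w ≠ 0) (hw : IsWeightVector μ w) (hE : ∀ i, ⁅chevE i, w⁆ = 0) :
    Submodule.span ℂ (Set.range (word w)) = ⊤ := by
  refine eq_top_of_stable hV _ (fun i => lie_mem_span _ ?_) (fun i => lie_mem_span _ ?_)
    (fun k => lie_mem_span _ ?_) (mem_span_word w []) hw0
  -- The raising operator is commuted to the right past one lowering operator at a time; each
  -- commutator is zero or a coroot, which acts on a word by a scalar.
  · rintro _ ⟨l, rfl⟩
    induction l with
    | nil => rw [word, hE]; exact Submodule.zero_mem _
    | cons j l ih =>
      rw [word, leibniz_lie]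
      refine Submodule.add_mem _ ?_ ?_
      · by_cases hij : i = j
        · subst hij
          rw [lie_chevE_chevF, isWeightVector_word hw l]
          exact Submodule.smul_mem _ _ (mem_span_word w l)
        · rw [lie_chevE_chevF_of_ne hij, zero_lie]
          exact Submodule.zero_mem _
      · refine lie_mem_span _ ?_ _ ih
        rintro _ ⟨l, rfl⟩
        exact mem_span_word w (j :: l)
  · rintro _ ⟨l, rfl⟩
    exact mem_span_word w (i :: l)
  · rintro _ ⟨l, rfl⟩
    rw [isWeightVector_word hw l]
    exact Submodule.smul_mem _ _ (mem_span_word w l)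

/-- If eigenvectors of an endomorphism span the space, then every eigenvalue occurs among the
eigenvalues of these vectors. -/
lemma exists_eq_of_span_eigenvectors {M ι : Type*} [AddCommGroup M] [Module ℂ M]
    (T : Module.End ℂ M) (v : ι → M) (c : ι → ℂ) (hv : ∀ i, T (v i) = c i • v i)
    (hs : Submodule.span ℂ (Set.range v) = ⊤) {u : M} (hu0 : u ≠ 0) {a : ℂ}
    (hu : T u = a • u) : ∃ i, a = c i := by
  by_contra! hne
  have hd := T.eigenspaces_iSupIndep a
  have htop : ⨆ b, ⨆ (_ : b ≠ a), T.eigenspace b = ⊤ := by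
    rw [eq_top_iff, ← hs, Submodule.span_le]
    rintro _ ⟨i, rfl⟩
    have h1 : v i ∈ T.eigenspace (c i) := Module.End.mem_eigenspace_iff.2 (hv i)
    exact (le_iSup₂_of_le (f := fun b (_ : b ≠ a) => T.eigenspace b) (c i) (hne i).symm le_rfl) h1
  rw [htop, disjoint_top, Submodule.eq_bot_iff] at hd
  exact hu0 (hd u (Module.End.mem_eigenspace_iff.2 hu))

lemma weight_ext {μ ν : Weight} (h1 : μ (1, 0, 0) = ν (1, 0, 0)) (h2 : μ (0, 1, 0) = ν (0, 1, 0))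
    (h3 : μ (0, 0, 1) = ν (0, 0, 1)) : μ = ν := by
  ext <;> simpa

lemma weight_apply (μ : Weight) (a b c : ℂ) :
    μ (a, b, c) = a * μ (1, 0, 0) + b * μ (0, 1, 0) + c * μ (0, 0, 1) := by
  have : ((a, b, c) : Cartan) = a • (1, 0, 0) + b • (0, 1, 0) + c • (0, 0, 1) := by simp
  rw [this, map_add, map_add, map_smul, map_smul, map_smul]
  simp

/-- If an irreducible module has a singular vector of weight `μ`, then all its weights lie in
`μ - ℕ α₀ - ℕ α₁`. -/
lemma exists_eq_sub_of_mem_weights (hV : LieModule.IsIrreducible ℂ Affine V) {μ : Weight} {w : V}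
    (hw0 : w ≠ 0) (hw : IsWeightVector μ w) (hE : ∀ i, ⁅chevE i, w⁆ = 0) {ν : Weight}
    (hν : ν ∈ weights V) :
    ∃ a b : ℕ, ν = μ - ((a : ℂ) • simpleRoot 0 + (b : ℂ) • simpleRoot 1) := by
  obtain ⟨u, hu0, hu⟩ := hν
  have hs := span_word_eq_top hV hw0 hw hE
  have key (k : Cartan) := exists_eq_of_span_eigenvectors
    (LieModule.toEnd ℂ Affine V k.toAffine) (word w) _
    (fun l => isWeightVector_word hw l k) hs hu0 (hu k)
  -- The elements d and α^∨/2 + d form a basis dual to (α₀, α₁), so each eigenvalue reads off one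
  -- coefficient; the words found may differ without harm. The third element, c, fixes the level.
  obtain ⟨l1, h1⟩ := key (0, 0, 1)
  obtain ⟨l2, h2⟩ := key (1 / 2, 0, 1)
  obtain ⟨l3, h3⟩ := key (0, 1, 0)
  refine ⟨l1.count 0, l2.count 1, weight_ext ?_ ?_ ?_⟩
  · rw [weight_apply ν] at h2
    simp [simpleRoot, α, δ] at h1 h2 ⊢
    rw [weight_apply μ] at h2
    linear_combination 2 * h2 - 2 * h1
  · simpa [simpleRoot, α, δ] using h3
  · simpa [simpleRoot, α, δ] using h1

end Representation

/-! ### Strings for an sl₂-triple of endomorphisms -/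

section Sl2

variable {M : Type*} [AddCommGroup M] [Module ℂ M] {E F H : Module.End ℂ M}

lemma cartan_pow_apply (hHF : ∀ u, H (F u) = F (H u) - (2 : ℂ) • F u) {p : ℂ} {u : M}
    (hu : H u = p • u) (n : ℕ) : H ((F ^ n) u) = (p - 2 * n) • (F ^ n) u := by
  induction n with
  | zero => simpa using hu
  | succ n ih =>
    rw [pow_succ', Module.End.mul_apply, hHF, ih, map_smul, ← sub_smul]
    push_cast
    congr 1; ring

lemma raise_pow_apply (hEF : ∀ u, E (F u) = F (E u) + H u)
    (hHF : ∀ u, H (F u) = F (H u) - (2 : ℂ) • F u) {p : ℂ} {u : M} (hu : H u = p • u) (n : ℕ) :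
    E ((F ^ (n + 1)) u) = (F ^ (n + 1)) (E u) + ((n + 1) * (p - n)) • (F ^ n) u := by
  induction n with
  | zero => simp [hEF, hu]
  | succ n ih =>
    rw [pow_succ' F (n + 1), Module.End.mul_apply, hEF, ih, cartan_pow_apply hHF hu,
      map_add, map_smul, Module.End.mul_apply, add_assoc, ← Module.End.mul_apply F (F ^ n),
      ← pow_succ', ← add_smul]
    push_cast
    congr 2; ring

/-- A vector of weight `p ∈ ℕ` on which `E` acts nilpotently vanishes if `F ^ p` kills it. -/
lemma eq_zero_of_lower_pow_eq_zero (hEF : ∀ u, E (F u) = F (E u) + H u)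
    (hHF : ∀ u, H (F u) = F (H u) - (2 : ℂ) • F u)
    (hHE : ∀ u, H (E u) = E (H u) + (2 : ℂ) • E u) (N : ℕ) :
    ∀ (p : ℕ) (u : M), H u = (p : ℂ) • u → (E ^ N) u = 0 → (F ^ p) u = 0 → u = 0 := by
  induction N with
  | zero => intro p u _ h _; simpa using h
  | succ N ih =>
    intro p u hu hE hF
    have hF' (n : ℕ) : (F ^ (p + n)) u = 0 := by
      rw [add_comm, pow_add, Module.End.mul_apply, hF, map_zero]
    -- `E u` has weight `p + 2` and smaller nilpotency order. Commuting `E` past `F ^ (p + 2)`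
    -- leaves only terms containing `F ^ p u`, so `F ^ (p + 2)` kills `E u` and induction applies.
    have hEu : E u = 0 := by
      refine ih (p + 2) (E u) ?_ ?_ ?_
      · rw [hHE, hu, map_smul, ← add_smul]
        push_cast; rfl
      · rw [← Module.End.mul_apply, ← pow_succ, hE]
      · have h1 := raise_pow_apply hEF hHF hu (p + 1)
        rw [hF' 1, smul_zero, add_zero, show p + 1 + 1 = p + 2 from rfl, hF' 2, map_zero] at h1
        exact h1.symm
    -- Once `E u = 0`, applying `E` to `F ^ (i + 1) u = 0` leaves `(i + 1)(p - i) F ^ i u`, whose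
    -- coefficient is nonzero for `i < p`.
    have hdown (n : ℕ) (hn : n ≤ p) : (F ^ (p - n)) u = 0 := by
      induction n with
      | zero => exact hF
      | succ n ihn =>
        have h1 := raise_pow_apply hEF hHF hu (p - (n + 1))
        rw [show p - (n + 1) + 1 = p - n by omega, ihn (by omega), hEu, map_zero, map_zero,
          zero_add] at h1
        refine (smul_eq_zero.1 h1.symm).resolve_left ?_
        rw [Nat.cast_sub hn]
        push_cast
        have h2 : (p : ℂ) - (n + 1) + 1 = ((p - n : ℕ) : ℂ) := by
          rw [Nat.cast_sub (by omega)]; ring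
        have h3 : (p : ℂ) - (p - (n + 1)) = ((n + 1 : ℕ) : ℂ) := by push_cast; ring
        rw [h2, h3]
        exact mul_ne_zero (Nat.cast_ne_zero.2 (by omega)) (Nat.cast_ne_zero.2 (by omega))
    simpa using hdown p le_rfl

end Sl2

/-! ### Serre relations, integrability and reflection invariance of weights -/

lemma serre_chevF {i j : Fin 2} (hij : i ≠ j) :
    ⁅chevF i, ⁅chevF i, ⁅chevF i, chevF j⁆⁆⁆ = 0 := by
  fin_cases i <;> fin_cases j
  · simp at hij
  · simp [chevF, lie_loopMono, toAffine_zero, lie_e_f, ← lie_skew e h, lie_h_e]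
  · simp [chevF, lie_loopMono, toAffine_zero, ← lie_skew f e, lie_e_f, ← lie_skew f h, lie_h_f]
  · simp at hij

lemma serre_chevE {i j : Fin 2} (hij : i ≠ j) :
    ⁅chevE i, ⁅chevE i, ⁅chevE i, chevE j⁆⁆⁆ = 0 := by
  fin_cases i <;> fin_cases j
  · simp at hij
  · simp [chevE, lie_loopMono, toAffine_zero, ← lie_skew f e, lie_e_f, ← lie_skew f h, lie_h_f]
  · simp [chevE, lie_loopMono, toAffine_zero, lie_e_f, ← lie_skew e h, lie_h_e]
  · simp at hij

lemma lie_chevE_toAffine (k : Cartan) (i : Fin 2) :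
    ⁅chevE i, k.toAffine⁆ = -(simpleRoot i k • chevE i) := by
  rw [← lie_skew, lie_toAffine_chevE]

lemma lie_chevF_toAffine (k : Cartan) (i : Fin 2) :
    ⁅chevF i, k.toAffine⁆ = simpleRoot i k • chevF i := by
  rw [← lie_skew, lie_toAffine_chevF, neg_neg]

lemma mem_engel_of_lie_eq_zero {x y : Affine} (h : ⁅x, ⁅x, ⁅x, y⁆⁆⁆ = 0) :
    y ∈ LieSubalgebra.engel ℂ x :=
  (LieSubalgebra.mem_engel_iff ℂ x y).2 ⟨3, by simpa [pow_succ] using h⟩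

/-- The Engel subalgebra is closed under brackets, so only generators need checking; the third power
of the adjoint action kills each of them, by the Serre and sl₂ relations. -/
lemma engel_chevF (i : Fin 2) : LieSubalgebra.engel ℂ (chevF i) = ⊤ := by
  refine eq_top_of_generators_mem _ (fun j => ?_) (fun j => ?_) (fun k => ?_) <;>
    apply mem_engel_of_lie_eq_zero
  · by_cases hij : j = i
    · subst hij
      rw [← lie_skew (chevF j) (chevE j), lie_chevE_chevF, lie_neg, lie_chevF_toAffine]
      simp
    · rw [← lie_skew (chevF i) (chevE j), lie_chevE_chevF_of_ne hij]
      simp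
  · by_cases hij : i = j
    · subst hij
      simp
    · exact serre_chevF hij
  · rw [lie_chevF_toAffine]
    simp

lemma engel_chevE (i : Fin 2) : LieSubalgebra.engel ℂ (chevE i) = ⊤ := by
  refine eq_top_of_generators_mem _ (fun j => ?_) (fun j => ?_) (fun k => ?_) <;>
    apply mem_engel_of_lie_eq_zero
  · by_cases hij : i = j
    · subst hij
      simp
    · exact serre_chevE hij
  · by_cases hij : i = j
    · subst hij
      rw [lie_chevE_chevF, lie_chevE_toAffine]
      simp
    · rw [lie_chevE_chevF_of_ne hij]
      simp
  · rw [lie_chevE_toAffine]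
    simp

section Representation

variable {V : Type*} [AddCommGroup V] [LieRingModule Affine V]

lemma chevE_chevF_apply (i : Fin 2) (u : V) :
    ⁅chevE i, ⁅chevF i, u⁆⁆ = ⁅chevF i, ⁅chevE i, u⁆⁆ + ⁅(simpleCoroot i).toAffine, u⁆ := by
  rw [leibniz_lie, lie_chevE_chevF, add_comm]

variable [Module ℂ V] [LieModule ℂ Affine V]

/-- If `ad x` is locally nilpotent and `x` acts nilpotently on some nonzero vector of an
irreducible module, then it acts locally nilpotently. -/
lemma exists_pow_eq_zero (hV : LieModule.IsIrreducible ℂ Affine V) {x : Affine}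
    (hx : LieSubalgebra.engel ℂ x = ⊤) {w : V} (hw0 : w ≠ 0) {N : ℕ}
    (hw : (LieModule.toEnd ℂ Affine V x ^ N) w = 0) (u : V) :
    ∃ n : ℕ, (LieModule.toEnd ℂ Affine V x ^ n) u = 0 := by
  have hmem (u : V) : u ∈ (LieModule.toEnd ℂ Affine V x).maxGenEigenspace 0 ↔
      ∃ n : ℕ, (LieModule.toEnd ℂ Affine V x ^ n) u = 0 := by
    simp [Module.End.mem_maxGenEigenspace]
  -- Every `y` is ad-nilpotent under `x`, so the generalized 0-eigenspace of `x` is stable under the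
  -- whole algebra.
  have hst (y : Affine) (v : V) (hv : v ∈ (LieModule.toEnd ℂ Affine V x).maxGenEigenspace 0) :
      ⁅y, v⁆ ∈ (LieModule.toEnd ℂ Affine V x).maxGenEigenspace 0 := by
    have hy : y ∈ (LieModule.toEnd ℂ Affine Affine x).maxGenEigenspace 0 := by
      have : y ∈ LieSubalgebra.engel ℂ x := hx ▸ LieSubalgebra.mem_top y
      rw [LieSubalgebra.mem_engel_iff] at this
      rw [Module.End.mem_maxGenEigenspace, zero_smul, sub_zero]
      exact this
    simpa using LieModule.lie_mem_maxGenEigenspace_toEnd hy hv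
  have htop := eq_top_of_stable hV _ (fun i => hst (chevE i)) (fun i => hst (chevF i))
    (fun k => hst k.toAffine) ((hmem w).2 ⟨N, hw⟩) hw0
  rw [← hmem, htop]
  exact Submodule.mem_top

lemma IsWeightVector.chevF_pow {μ : Weight} {v : V} (hv : IsWeightVector μ v) (i : Fin 2)
    (n : ℕ) : IsWeightVector (μ - (n : ℂ) • simpleRoot i)
      ((LieModule.toEnd ℂ Affine V (AffineSl2.chevF i) ^ n) v) := by
  induction n with
  | zero => simpa using hv
  | succ n ih =>
    rw [pow_succ', Module.End.mul_apply, LieModule.toEnd_apply_apply]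
    convert ih.chevF i using 1
    push_cast
    rw [add_smul, one_smul]; abel

lemma IsWeightVector.chevE_pow {μ : Weight} {v : V} (hv : IsWeightVector μ v) (i : Fin 2)
    (n : ℕ) : IsWeightVector (μ + (n : ℂ) • simpleRoot i)
      ((LieModule.toEnd ℂ Affine V (AffineSl2.chevE i) ^ n) v) := by
  induction n with
  | zero => simpa using hv
  | succ n ih =>
    rw [pow_succ', Module.End.mul_apply, LieModule.toEnd_apply_apply]
    convert ih.chevE i using 1
    push_cast
    rw [add_smul, one_smul]; abel

lemma coroot_chevF_apply (i : Fin 2) (u : V) :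
    ⁅(simpleCoroot i).toAffine, ⁅chevF i, u⁆⁆ =
      ⁅chevF i, ⁅(simpleCoroot i).toAffine, u⁆⁆ - (2 : ℂ) • ⁅chevF i, u⁆ := by
  rw [leibniz_lie, lie_toAffine_chevF, simpleRoot_simpleCoroot, neg_lie, smul_lie]
  abel

lemma coroot_chevE_apply (i : Fin 2) (u : V) :
    ⁅(simpleCoroot i).toAffine, ⁅chevE i, u⁆⁆ =
      ⁅chevE i, ⁅(simpleCoroot i).toAffine, u⁆⁆ + (2 : ℂ) • ⁅chevE i, u⁆ := by
  rw [leibniz_lie, lie_toAffine_chevE, simpleRoot_simpleCoroot, smul_lie]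
  abel

/-- A nonzero singular vector of weight `Λ` with `Λ(α_i^∨) = N ∈ ℕ` is killed by `f_i ^ (N + 1)`. -/
lemma chevF_pow_eq_zero (hV : LieModule.IsIrreducible ℂ Affine V) {Λ : Weight} {v : V}
    (hv0 : v ≠ 0) (hv : IsWeightVector Λ v) (hE : ∀ i, ⁅chevE i, v⁆ = 0) (i : Fin 2) {N : ℕ}
    (hN : Λ (simpleCoroot i) = N) :
    (LieModule.toEnd ℂ Affine V (chevF i) ^ (N + 1)) v = 0 := by
  -- Otherwise this vector is singular, the critical coefficient (N+1)(N-N) being zero. All weights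
  -- would then lie below Λ - (N+1)α_i, including Λ itself.
  by_contra hne
  have hcomm (j : Fin 2) (hij : j ≠ i) (n : ℕ) :
      ⁅chevE j, (LieModule.toEnd ℂ Affine V (chevF i) ^ n) v⁆ = 0 := by
    induction n with
    | zero => simpa using hE j
    | succ n ih =>
      rw [pow_succ', Module.End.mul_apply, LieModule.toEnd_apply_apply, leibniz_lie,
        lie_chevE_chevF_of_ne hij, ih]
      simp
  have hsing (j : Fin 2) : ⁅chevE j, (LieModule.toEnd ℂ Affine V (chevF i) ^ (N + 1)) v⁆ = 0 := by
    by_cases hij : j = i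
    · subst hij
      have := raise_pow_apply (E := LieModule.toEnd ℂ Affine V (chevE j))
        (F := LieModule.toEnd ℂ Affine V (chevF j))
        (H := LieModule.toEnd ℂ Affine V (simpleCoroot j).toAffine)
        (chevE_chevF_apply j) (coroot_chevF_apply j) (hv (simpleCoroot j)) N
      simpa [hE, hN] using this
    · exact hcomm j hij _
  obtain ⟨a, b, hab⟩ := exists_eq_sub_of_mem_weights hV hne (hv.chevF_pow i (N + 1)) hsing
    ⟨v, hv0, hv⟩
  have h0 := LinearMap.congr_fun hab (0, 0, 1)
  have h1 := LinearMap.congr_fun hab (1 / 2, 0, 1)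
  fin_cases i
  · simp [simpleRoot, α, δ] at h0
    have : ((N + 1 + a : ℕ) : ℂ) = 0 := by push_cast; linear_combination h0
    exact absurd (Nat.cast_eq_zero.1 this) (by omega)
  · simp [simpleRoot, α, δ] at h1
    have : ((N + 1 + b : ℕ) : ℂ) = 0 := by push_cast; linear_combination h1
    exact absurd (Nat.cast_eq_zero.1 this) (by omega)

/-- A module is integrable if the Chevalley generators act locally nilpotently. -/
structure IsIntegrable (V : Type*) [AddCommGroup V] [Module ℂ V] [LieRingModule Affine V]
    [LieModule ℂ Affine V] : Prop where
  chevE : ∀ i, ∀ v : V, ∃ n : ℕ, (LieModule.toEnd ℂ Affine V (chevE i) ^ n) v = 0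
  chevF : ∀ i, ∀ v : V, ∃ n : ℕ, (LieModule.toEnd ℂ Affine V (chevF i) ^ n) v = 0

lemma isIntegrable (hV : LieModule.IsIrreducible ℂ Affine V) {Λ : Weight} {v : V}
    (hv0 : v ≠ 0) (hv : IsWeightVector Λ v) (hE : ∀ i, ⁅chevE i, v⁆ = 0)
    (hN : ∀ i, ∃ N : ℕ, Λ (simpleCoroot i) = N) : IsIntegrable V where
  chevE i := exists_pow_eq_zero hV (engel_chevE i) hv0 (N := 1) (by simpa using hE i)
  chevF i := by
    obtain ⟨N, hN⟩ := hN i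
    exact exists_pow_eq_zero hV (engel_chevF i) hv0 (chevF_pow_eq_zero hV hv0 hv hE i hN)

/-- If `f_i ^ a` killed the weight vector, so would `f_i ^ p`, against
`eq_zero_of_lower_pow_eq_zero`. -/
lemma sub_smul_mem_weights (hV : IsIntegrable V) {μ : Weight} (hμ : μ ∈ weights V) (i : Fin 2)
    {p : ℕ} (hp : μ (simpleCoroot i) = p) {a : ℕ} (ha : a ≤ p) :
    μ - (a : ℂ) • simpleRoot i ∈ weights V := by
  obtain ⟨v, hv0, hv⟩ := hμ
  obtain ⟨N, hN⟩ := hV.chevE i v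
  refine ⟨_, fun h0 => hv0 ?_, IsWeightVector.chevF_pow hv i a⟩
  refine eq_zero_of_lower_pow_eq_zero (E := LieModule.toEnd ℂ Affine V (chevE i))
    (F := LieModule.toEnd ℂ Affine V (chevF i))
    (H := LieModule.toEnd ℂ Affine V (simpleCoroot i).toAffine)
    (chevE_chevF_apply i) (coroot_chevF_apply i) (coroot_chevE_apply i) N p v ?_ hN ?_
  · rw [← hp]
    exact hv (simpleCoroot i)
  · rw [← Nat.sub_add_cancel ha, pow_add, Module.End.mul_apply, h0, map_zero]

/-- The same argument for the opposite triple (f, e, -h). -/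
lemma add_smul_mem_weights (hV : IsIntegrable V) {μ : Weight} (hμ : μ ∈ weights V) (i : Fin 2)
    {p : ℕ} (hp : μ (simpleCoroot i) = -p) {a : ℕ} (ha : a ≤ p) :
    μ + (a : ℂ) • simpleRoot i ∈ weights V := by
  obtain ⟨v, hv0, hv⟩ := hμ
  obtain ⟨N, hN⟩ := hV.chevF i v
  refine ⟨_, fun h0 => hv0 ?_, IsWeightVector.chevE_pow hv i a⟩
  refine eq_zero_of_lower_pow_eq_zero (E := LieModule.toEnd ℂ Affine V (chevF i))
    (F := LieModule.toEnd ℂ Affine V (chevE i))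
    (H := -LieModule.toEnd ℂ Affine V (simpleCoroot i).toAffine)
    (fun u => ?_) (fun u => ?_) (fun u => ?_) N p v ?_ hN ?_
  · simp [chevE_chevF_apply]
  · simp [coroot_chevE_apply]; abel
  · simp [coroot_chevF_apply]; abel
  · have := hv (simpleCoroot i)
    rw [hp] at this
    simp [this]
  · rw [← Nat.sub_add_cancel ha, pow_add, Module.End.mul_apply, h0, map_zero]

/-- The weights of an integrable module are stable under the simple reflections. -/
lemma sub_coroot_smul_mem_weights (hV : IsIntegrable V) {μ : Weight} (hμ : μ ∈ weights V)
    (i : Fin 2) {z : ℤ} (hz : μ (simpleCoroot i) = z) : μ - (z : ℂ) • simpleRoot i ∈ weights V := by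
  obtain ⟨p, rfl | rfl⟩ := z.eq_nat_or_neg
  · exact_mod_cast sub_smul_mem_weights hV hμ i (p := p) (by simpa using hz) le_rfl
  · have := add_smul_mem_weights hV hμ i (p := p) (by simpa using hz) le_rfl
    simpa using this

end Representation

/-! ### The δ-maximal weights -/

/-- The weight `m Λ₀ + (k / 2) α + n δ`. -/
def levelWeight (m k n : ℤ) : Weight := (m : ℂ) • Λ₀ + ((k : ℂ) / 2) • α + (n : ℂ) • δ

lemma wt_eq_levelWeight (m j : ℕ) : wt m j = levelWeight m j 0 := by
  simp [wt, levelWeight]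

lemma levelWeight_coroot_zero (m k n : ℤ) :
    levelWeight m k n (simpleCoroot 0) = ((m - k : ℤ) : ℂ) := by
  simp [levelWeight, simpleCoroot, Λ₀, α, δ]; ring

lemma levelWeight_coroot_one (m k n : ℤ) :
    levelWeight m k n (simpleCoroot 1) = (k : ℂ) := by
  simp [levelWeight, simpleCoroot, Λ₀, α, δ]

lemma levelWeight_sub_smul_root_zero (m k n z : ℤ) :
    levelWeight m k n - (z : ℂ) • simpleRoot 0 = levelWeight m (k + 2 * z) (n - z) := by
  apply weight_ext <;> simp [levelWeight, simpleRoot, Λ₀, α, δ]; ring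

lemma levelWeight_sub_smul_root_one (m k n z : ℤ) :
    levelWeight m k n - (z : ℂ) • simpleRoot 1 = levelWeight m (k - 2 * z) n := by
  apply weight_ext <;> simp [levelWeight, simpleRoot, Λ₀, α, δ]; ring

lemma levelWeight_add_smul_δ (m k n z : ℤ) :
    levelWeight m k n + (z : ℂ) • δ = levelWeight m k (n + z) := by
  apply weight_ext <;> simp [levelWeight, Λ₀, α, δ]

lemma levelWeight_inj {m k n m' k' n' : ℤ} (h : levelWeight m k n = levelWeight m' k' n') :
    m = m' ∧ k = k' ∧ n = n' := by
  have h1 := LinearMap.congr_fun h (1, 0, 0)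
  have h2 := LinearMap.congr_fun h (0, 1, 0)
  have h3 := LinearMap.congr_fun h (0, 0, 1)
  simp [levelWeight, Λ₀, α, δ] at h1 h2 h3
  exact ⟨h2, h1, h3⟩

/-- The properties which characterize the function `N` such that the `δ`-maximal weights of the
irreducible module with highest weight `m Λ₀ + (j / 2) α` are the `m Λ₀ + (k / 2) α + N(k) δ`
with `k ≡ j` modulo `2`. -/
structure IsDepthFunction (m j : ℤ) (N : ℤ → ℤ) : Prop where
  neg : ∀ k, 2 ∣ k - j → N (-k) = N k
  refl : ∀ k, 2 ∣ k - j → N (2 * m - k) = N k - m + k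
  eq_zero : ∀ k, 2 ∣ k - j → 0 ≤ k → k ≤ j → N k = 0
  two_mul_eq : ∀ k, 2 ∣ k - j → j ≤ k → k ≤ m → 2 * N k = j - k

section Representation

variable {V : Type*} [AddCommGroup V] [Module ℂ V] [LieRingModule Affine V]

lemma exists_singular_vector {Λ : Weight} (hV : IsIrreducibleHighestWeight V Λ) :
    ∃ v : V, v ≠ 0 ∧ IsWeightVector Λ v ∧ ∀ i, ⁅chevE i, v⁆ = 0 := by
  obtain ⟨v, hv0, hv, he, hn⟩ := hV.exists_highestWeightVector
  refine ⟨v, hv0, hv, fun i => ?_⟩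
  fin_cases i
  · exact hn 1 one_pos f
  · exact he

variable {m j : ℕ}

lemma highestWeight_mem_weights (hV : IsIrreducibleHighestWeight V (wt m j)) :
    levelWeight m j 0 ∈ weights V := by
  obtain ⟨v, hv0, hv, -⟩ := exists_singular_vector hV
  rw [← wt_eq_levelWeight]
  exact ⟨v, hv0, hv⟩

variable [LieModule ℂ Affine V]

lemma isIntegrable_of_isIrreducibleHighestWeight (hj : j ≤ m)
    (hV : IsIrreducibleHighestWeight V (wt m j)) : IsIntegrable V := by
  obtain ⟨v, hv0, hv, hE⟩ := exists_singular_vector hV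
  refine isIntegrable hV.irreducible hv0 hv hE fun i => ?_
  rw [wt_eq_levelWeight]
  fin_cases i
  · refine ⟨m - j, (levelWeight_coroot_zero _ _ _).trans ?_⟩
    rw [Nat.cast_sub hj]; push_cast; rfl
  · exact ⟨j, (levelWeight_coroot_one _ _ _).trans (by simp)⟩

/-- Subtracting aα₀ + bα₁ from the highest weight gives k = j + 2a - 2b and n = -a; the two
inequalities express a ≥ 0 and b ≥ 0. -/
lemma eq_levelWeight_of_mem_weights (hV : IsIrreducibleHighestWeight V (wt m j)) {μ : Weight}
    (hμ : μ ∈ weights V) :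
    ∃ k n : ℤ, μ = levelWeight m k n ∧ 2 ∣ k - j ∧ n ≤ 0 ∧ 2 * n ≤ j - k := by
  obtain ⟨v, hv0, hv, hE⟩ := exists_singular_vector hV
  obtain ⟨a, b, rfl⟩ := exists_eq_sub_of_mem_weights hV.irreducible hv0 hv hE hμ
  refine ⟨j + 2 * (a : ℤ) - 2 * (b : ℤ), 0 - a, ?_, by omega, by omega, by omega⟩
  rw [← levelWeight_sub_smul_root_one, ← levelWeight_sub_smul_root_zero, wt_eq_levelWeight]
  push_cast
  rw [sub_sub]

lemma le_of_levelWeight_mem_weights (hV : IsIrreducibleHighestWeight V (wt m j)) {k n : ℤ}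
    (h : levelWeight m k n ∈ weights V) : n ≤ 0 ∧ 2 * n ≤ j - k := by
  obtain ⟨k', n', h1, -, h2⟩ := eq_levelWeight_of_mem_weights hV h
  obtain ⟨-, rfl, rfl⟩ := levelWeight_inj h1
  exact h2

lemma levelWeight_neg_mem_weights (hV : IsIntegrable V) {m k n : ℤ}
    (h : levelWeight m k n ∈ weights V) : levelWeight m (-k) n ∈ weights V := by
  have := sub_coroot_smul_mem_weights hV h 1 (levelWeight_coroot_one m k n)
  rw [levelWeight_sub_smul_root_one] at this
  convert this using 2; ring

lemma levelWeight_refl_mem_weights (hV : IsIntegrable V) {m k n : ℤ}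
    (h : levelWeight m k n ∈ weights V) : levelWeight m (2 * m - k) (n - m + k) ∈ weights V := by
  have := sub_coroot_smul_mem_weights hV h 0 (levelWeight_coroot_zero m k n)
  rw [levelWeight_sub_smul_root_zero] at this
  convert this using 2 <;> ring

/-- The bound 0 is attained on the α₁-string through the highest weight. -/
lemma isGreatest_of_le (hj : j ≤ m) (hV : IsIrreducibleHighestWeight V (wt m j)) {k : ℤ}
    (hk : 2 ∣ k - j) (h0 : 0 ≤ k) (hkj : k ≤ j) :
    IsGreatest {n : ℤ | levelWeight m k n ∈ weights V} 0 := by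
  have hI := isIntegrable_of_isIrreducibleHighestWeight hj hV
  refine ⟨?_, fun n hn => (le_of_levelWeight_mem_weights hV hn).1⟩
  obtain ⟨a, ha⟩ := hk
  have := sub_smul_mem_weights hI (highestWeight_mem_weights hV) 1 (p := j) (a := (-a).toNat)
    (by simp [levelWeight_coroot_one]) (by omega)
  have hc : (((-a).toNat : ℕ) : ℂ) = ((-a : ℤ) : ℂ) := by
    rw [← Int.cast_natCast, Int.toNat_of_nonneg (by omega)]
  rw [hc, levelWeight_sub_smul_root_one] at this
  rwa [show (j : ℤ) - 2 * -a = k by omega] at this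

/-- The α₀-string through the highest weight attains the bound 2n ≤ j - k. -/
lemma isGreatest_of_ge (hj : j ≤ m) (hV : IsIrreducibleHighestWeight V (wt m j)) {k a : ℤ}
    (hk : k = j + 2 * a) (hjk : j ≤ k) (hkm : k ≤ m) :
    IsGreatest {n : ℤ | levelWeight m k n ∈ weights V} (-a) := by
  have hI := isIntegrable_of_isIrreducibleHighestWeight hj hV
  refine ⟨?_, fun n hn => ?_⟩
  · have := sub_smul_mem_weights hI (highestWeight_mem_weights hV) 0 (p := m - j) (a := a.toNat)
      (by rw [levelWeight_coroot_zero, Nat.cast_sub hj]; push_cast; rfl) (by omega)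
    have hc : ((a.toNat : ℕ) : ℂ) = (a : ℂ) := by
      rw [← Int.cast_natCast, Int.toNat_of_nonneg (by omega)]
    rw [hc, levelWeight_sub_smul_root_zero, ← hk, zero_sub] at this
    exact this
  · have := (le_of_levelWeight_mem_weights hV hn).2
    omega

/-- Descent on |k|: a sign change makes k nonnegative, and for k > m the reflection k ↦ 2m - k
lowers |k| because m > 0. The strings above cover 0 ≤ k ≤ m. -/
lemma exists_levelWeight_mem_weights (hm : 0 < m) (hj : j ≤ m)
    (hV : IsIrreducibleHighestWeight V (wt m j)) (K : ℕ) :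
    ∀ k : ℤ, k.natAbs = K → 2 ∣ k - j → ∃ n, levelWeight m k n ∈ weights V := by
  have hI := isIntegrable_of_isIrreducibleHighestWeight hj hV
  induction K using Nat.strong_induction_on with
  | _ K ih =>
    have hnonneg (k : ℤ) (hk : k.natAbs = K) (hkj : 2 ∣ k - j) (h0 : 0 ≤ k) :
        ∃ n, levelWeight m k n ∈ weights V := by
      by_cases hkm : k ≤ m
      · by_cases h : k ≤ j
        · exact ⟨_, (isGreatest_of_le hj hV hkj h0 h).1⟩
        · obtain ⟨a, ha⟩ := hkj
          exact ⟨_, (isGreatest_of_ge (a := a) hj hV (by omega) (by omega) hkm).1⟩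
      · obtain ⟨n, hn⟩ := ih (2 * m - k).natAbs (by omega) (2 * m - k) rfl (by omega)
        have := levelWeight_refl_mem_weights hI hn
        rw [show (2 : ℤ) * m - (2 * m - k) = k by ring] at this
        exact ⟨_, this⟩
    intro k hk hkj
    by_cases h0 : 0 ≤ k
    · exact hnonneg k hk hkj h0
    · obtain ⟨n, hn⟩ := hnonneg (-k) (by omega) (by omega) (by omega)
      have := levelWeight_neg_mem_weights hI hn
      rw [neg_neg] at this
      exact ⟨n, this⟩

/-- The `δ`-maximal weights of the irreducible module with highest weight `m Λ₀ + (j / 2) α`. -/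
lemma exists_isDepthFunction (hm : 0 < m) (hj : j ≤ m)
    (hV : IsIrreducibleHighestWeight V (wt m j)) :
    ∃ N : ℤ → ℤ, IsDepthFunction m j N ∧
      ∀ μ, μ ∈ maximalWeights V ↔ ∃ k : ℤ, 2 ∣ k - j ∧ μ = levelWeight m k (N k) := by
  have hI := isIntegrable_of_isIrreducibleHighestWeight hj hV
  have hex (k : ℤ) : ∃ n : ℤ, 2 ∣ k - j →
      IsGreatest {n : ℤ | levelWeight m k n ∈ weights V} n := by
    by_cases hk : 2 ∣ k - (j : ℤ)
    · obtain ⟨n, h1, h2⟩ := Int.exists_greatest_of_bdd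
        (P := fun n => levelWeight m k n ∈ weights V)
        ⟨0, fun z hz => (le_of_levelWeight_mem_weights hV hz).1⟩
        (exists_levelWeight_mem_weights hm hj hV _ k rfl hk)
      exact ⟨n, fun _ => ⟨h1, h2⟩⟩
    -- For k of the wrong parity the value of `N` is never used.
    · exact ⟨0, fun h => absurd h hk⟩
  choose N hN using hex
  refine ⟨N, ⟨fun k hk => ?_, fun k hk => ?_, fun k hk h0 hkj => ?_, fun k hk hjk hkm => ?_⟩, ?_⟩
  · have h1 := hN k hk
    have h2 := hN (-k) (by omega)
    refine le_antisymm (h1.2 ?_) (h2.2 (levelWeight_neg_mem_weights hI h1.1))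
    simpa using levelWeight_neg_mem_weights hI h2.1
  · have h1 := hN k hk
    have h2 := hN (2 * m - k) (by omega)
    have h3 := h2.2 (levelWeight_refl_mem_weights hI h1.1)
    have h4 := levelWeight_refl_mem_weights hI h2.1
    rw [show (2 : ℤ) * m - (2 * m - k) = k by ring] at h4
    have h5 := h1.2 h4
    omega
  · exact (hN k hk).unique (isGreatest_of_le hj hV hk h0 hkj)
  · obtain ⟨a, ha⟩ := id hk
    have := (hN k hk).unique (isGreatest_of_ge (a := a) hj hV (by omega) hjk hkm)
    omega
  · intro μ
    constructor
    · rintro ⟨h1, h2⟩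
      obtain ⟨k, n, rfl, hk, -⟩ := eq_levelWeight_of_mem_weights hV h1
      refine ⟨k, hk, ?_⟩
      have h3 := (hN k hk).2 h1
      by_contra hne
      have hlt : n < N k := lt_of_le_of_ne h3 fun h => hne (by rw [h])
      refine h2 (N k - n).toNat (by omega) ?_
      have hc : (((N k - n).toNat : ℕ) : ℂ) = ((N k - n : ℤ) : ℂ) := by
        rw [← Int.cast_natCast, Int.toNat_of_nonneg (by omega)]
      rw [hc, levelWeight_add_smul_δ, add_sub_cancel]
      exact (hN k hk).1
    · rintro ⟨k, hk, rfl⟩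
      refine ⟨(hN k hk).1, fun n hn hmem => ?_⟩
      have := levelWeight_add_smul_δ m k (N k) n
      push_cast at this
      rw [this] at hmem
      have := (hN k hk).2 hmem
      omega

end Representation

/-! ### Monotonicity of depth functions -/

section DepthFunction

variable {m j : ℤ} {N : ℤ → ℤ}

namespace IsDepthFunction

/-- Composition of the reflections k ↦ -k and k ↦ 2m - k. -/
lemma add_period (h : IsDepthFunction m j N) {k : ℤ} (hk : 2 ∣ k - j) :
    N (k + 2 * m) = N k - k - m := by
  have h1 := h.refl (-k) (by omega)
  rw [h.neg k hk, show 2 * m - -k = k + 2 * m by ring] at h1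
  omega

/-- The drops of a depth function between consecutive arguments. -/
lemma drop_bounds (h : IsDepthFunction m j N) (hm : 0 < m) (hj : j ≤ m) (K : ℕ) :
    ∀ k : ℤ, k.toNat = K → 0 ≤ k → 2 ∣ k - j → N (k + 2) ≤ N k ∧ (j ≤ k → N (k + 2) + 1 ≤ N k) ∧
      (m - 1 ≤ k → N (k + 2) + 1 ≤ N k) ∧ (2 * m - j ≤ k → N (k + 2) + 2 ≤ N k) := by
  have base (k : ℤ) (hk : 2 ∣ k - j) (h0 : 0 ≤ k) (hkm : k ≤ m) :
      (k ≤ j ∧ N k = 0) ∨ (j ≤ k ∧ 2 * N k = j - k) := by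
    by_cases hkj : k ≤ j
    · exact Or.inl ⟨hkj, h.eq_zero k hk h0 hkj⟩
    · exact Or.inr ⟨by omega, h.two_mul_eq k hk (by omega) hkm⟩
  induction K using Nat.strong_induction_on with
  | _ K ih =>
    intro k hK h0 hk
    by_cases h1 : k + 2 ≤ m
    · have := base k hk h0 (by omega)
      have := base (k + 2) (by omega) (by omega) h1
      omega
    by_cases h2 : k + 1 = m
    · have := h.refl k hk
      rw [show 2 * m - k = k + 2 by omega] at this
      omega
    by_cases h3 : k + 2 ≤ 2 * m
    · have e1 := h.refl k hk
      have e2 := h.refl (k + 2) (by omega)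
      have := base (2 * m - k) (by omega) (by omega) (by omega)
      have := base (2 * m - (k + 2)) (by omega) (by omega) (by omega)
      omega
    by_cases h4 : k + 1 = 2 * m
    · have e1 := h.refl k hk
      have e2 := h.refl (k + 2) (by omega)
      have e3 := h.neg 1 (by omega)
      rw [show 2 * m - k = 1 by omega] at e1
      rw [show 2 * m - (k + 2) = -1 by omega] at e2
      omega
    -- For k ≥ 2m, shifting by the period adds exactly 2 to the drop, so monotonicity at k - 2m
    -- already gives a drop of at least 2.
    · have e1 := h.add_period (k := k - 2 * m) (by omega)
      have e2 := h.add_period (k := k - 2 * m + 2) (by omega)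
      rw [show k - 2 * m + 2 * m = k by ring] at e1
      rw [show k - 2 * m + 2 + 2 * m = k + 2 by ring] at e2
      have := (ih (k - 2 * m).toNat (by omega) (k - 2 * m) rfl (by omega) (by omega)).1
      omega

variable (h : IsDepthFunction m j N) (hm : 0 < m) (hj : j ≤ m)
include h hm hj

/-- Sums the individual drops. Strictness comes from the last one: by parity, its starting point is
already at least j, respectively 2m - j. -/
lemma add_two_mul_le {k : ℤ} (h0 : 0 ≤ k) (hk : 2 ∣ k - j) (n : ℕ) :
    N (k + 2 * n) ≤ N k ∧ (j < k + 2 * n → 0 < n → N (k + 2 * n) < N k) ∧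
      (m - 1 ≤ k → N (k + 2 * n) + n ≤ N k) ∧
      (m - 1 ≤ k → 2 * m - j < k + 2 * n → 0 < n → N (k + 2 * n) + n < N k) := by
  induction n with
  | zero => simp
  | succ n ih =>
    obtain ⟨h1, h2, h3, h4⟩ :=
      h.drop_bounds hm hj _ (k + 2 * n) rfl (by omega) (by omega)
    push_cast
    rw [show k + 2 * ((n : ℤ) + 1) = k + 2 * n + 2 by ring]
    omega

/-- A depth function is monotone in `|k|`. -/
lemma le_of_abs_le {a b : ℤ} (ha : 2 ∣ a - j) (hb : 2 ∣ b - j) (hab : |a| ≤ |b|) :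
    N b ≤ N a ∧ (|a| < |b| → j < |b| → N b < N a) := by
  have habs (c : ℤ) (hc : 2 ∣ c - j) : N |c| = N c := by
    rcases abs_choice c with h1 | h1 <;> rw [h1]
    exact h.neg c hc
  have := h.add_two_mul_le hm hj (k := |a|) (abs_nonneg a) (by grind) ((|b| - |a|) / 2).toNat
  rw [show |a| + 2 * (((|b| - |a|) / 2).toNat : ℤ) = |b| by grind, habs a ha, habs b hb] at this
  refine ⟨this.1, fun h1 h2 => this.2.1 h2 (by grind)⟩

/-- The function `2 N(k) + k` is monotone in `|k - m|`. -/
lemma two_mul_add_le_of_abs_le {a b : ℤ} (ha : 2 ∣ a - j) (hb : 2 ∣ b - j)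
    (hab : |a - m| ≤ |b - m|) :
    2 * N b + b ≤ 2 * N a + a ∧ (|a - m| < |b - m| → m - j < |b - m| →
      2 * N b + b < 2 * N a + a) := by
  have habs (c : ℤ) (hc : 2 ∣ c - j) : 2 * N (m + |c - m|) + (m + |c - m|) = 2 * N c + c := by
    rcases abs_choice (c - m) with h1 | h1 <;> rw [h1]
    · rw [show m + (c - m) = c by ring]
    · rw [show m + -(c - m) = 2 * m - c by ring, h.refl c hc]
      ring
  have := h.add_two_mul_le hm hj (k := m + |a - m|) (by positivity) (by grind)
    ((|b - m| - |a - m|) / 2).toNat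
  rw [show m + |a - m| + 2 * (((|b - m| - |a - m|) / 2).toNat : ℤ) = m + |b - m| by grind] at this
  have e1 := habs a ha
  have e2 := habs b hb
  have h0 := abs_nonneg (a - m)
  constructor
  · have := this.2.2.1 (by omega)
    grind
  · intro h1 h2
    have := this.2.2.2 (by omega) (by omega) (by grind)
    grind

end IsDepthFunction

end DepthFunction

/-! ### The affine Weyl group in coordinates -/

section Weyl

/-- The linear map `v` acts on the weights as `w ∘ t_r`, where the finite part `w` is
multiplication by `s` on `α` and `t_r` is a translation. -/
def ActsAs (s r : ℤ) (v : Weight ≃ₗ[ℂ] Weight) : Prop :=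
  ∀ M x n : ℤ, v (levelWeight M x n) =
    levelWeight M (s * x + 2 * M * r) (n - s * x * r - M * r ^ 2)

lemma actsAs_one : ActsAs 1 0 1 := by
  intro M x n
  change levelWeight M x n = _
  congr 1 <;> ring

lemma simpleReflection_apply (i : Fin 2) (μ : Weight) :
    simpleReflection i μ = μ - μ (simpleCoroot i) • simpleRoot i := rfl

lemma ActsAs.simpleReflection_zero_mul {s r : ℤ} {v : Weight ≃ₗ[ℂ] Weight} (hv : ActsAs s r v) :
    ActsAs (-s) (1 - r) (simpleReflection 0 * v) := by
  intro M x n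
  rw [LinearEquiv.mul_apply, hv M x n, simpleReflection_apply, levelWeight_coroot_zero, levelWeight_sub_smul_root_zero]
  congr 1 <;> ring

lemma ActsAs.simpleReflection_one_mul {s r : ℤ} {v : Weight ≃ₗ[ℂ] Weight} (hv : ActsAs s r v) :
    ActsAs (-s) (-r) (simpleReflection 1 * v) := by
  intro M x n
  rw [LinearEquiv.mul_apply, hv M x n, simpleReflection_apply, levelWeight_coroot_one, levelWeight_sub_smul_root_one]
  congr 1 <;> ring

/-- Each simple reflection negates `s`, so `s` is the parity of the word. -/
lemma exists_actsAs_prod (l : List (Fin 2)) :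
    ∃ r, ActsAs ((-1) ^ l.length) r (l.map simpleReflection).prod := by
  induction l with
  | nil => exact ⟨0, actsAs_one⟩
  | cons i l ih =>
    obtain ⟨r, hr⟩ := ih
    rw [List.map_cons, List.prod_cons, List.length_cons, pow_succ, mul_neg_one]
    fin_cases i
    · exact ⟨_, hr.simpleReflection_zero_mul⟩
    · exact ⟨_, hr.simpleReflection_one_mul⟩

/-- At level 0 the translation does not affect the α-coordinate, which exposes `s`. Thus word parity
depends only on the group element. -/
lemma ActsAs.unique {s r s' r' : ℤ} {v : Weight ≃ₗ[ℂ] Weight} (h : ActsAs s r v)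
    (h' : ActsAs s' r' v) : s = s' := by
  have := levelWeight_inj ((h 0 1 0).symm.trans (h' 0 1 0))
  simpa using this.2.1

lemma exists_list_of_mem_weylGroup {v : Weight ≃ₗ[ℂ] Weight} (hv : v ∈ weylGroup) :
    ∃ l : List (Fin 2), (l.map simpleReflection).prod = v := by
  induction hv using Subgroup.closure_induction with
  | mem x hx =>
    obtain ⟨i, rfl⟩ := hx
    exact ⟨[i], by simp⟩
  | one => exact ⟨[], rfl⟩
  | mul x y _ _ hx hy =>
    obtain ⟨l, rfl⟩ := hx
    obtain ⟨l', rfl⟩ := hy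
    exact ⟨l ++ l', by simp⟩
  | inv x _ hx =>
    obtain ⟨l, rfl⟩ := hx
    refine ⟨l.reverse, ?_⟩
    rw [List.prod_inv_reverse, List.map_map, List.map_reverse]
    congr 3

lemma exists_actsAs_sign (v : weylGroup) : ∃ r, ActsAs (sign v) r v.1 := by
  obtain ⟨l, hl⟩ := exists_list_of_mem_weylGroup v.2
  have hmem : length v ∈ {n | ∃ l : List (Fin 2), l.length = n ∧
      (l.map simpleReflection).prod = v} := Nat.sInf_mem ⟨_, l, rfl, hl⟩
  obtain ⟨l', h1, h2⟩ := hmem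
  obtain ⟨r, hr⟩ := exists_actsAs_prod l'
  rw [h1, h2] at hr
  exact ⟨r, hr⟩

lemma simpleReflection_mem (i : Fin 2) : simpleReflection i ∈ weylGroup :=
  Subgroup.subset_closure ⟨i, rfl⟩

/-- The product of the two simple reflections, in either order, changes `r` by one and keeps the
sign. -/
lemma exists_mem_weylGroup_actsAs_one (r : ℤ) : ∃ v ∈ weylGroup, ActsAs 1 r v := by
  induction r using Int.induction_on with
  | zero => exact ⟨1, weylGroup.one_mem, actsAs_one⟩
  | succ r ih =>
    obtain ⟨v, hv, h⟩ := ih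
    refine ⟨_, weylGroup.mul_mem (simpleReflection_mem 0)
      (weylGroup.mul_mem (simpleReflection_mem 1) hv), ?_⟩
    convert h.simpleReflection_one_mul.simpleReflection_zero_mul using 1 <;> ring
  | pred r ih =>
    obtain ⟨v, hv, h⟩ := ih
    refine ⟨_, weylGroup.mul_mem (simpleReflection_mem 1)
      (weylGroup.mul_mem (simpleReflection_mem 0) hv), ?_⟩
    convert h.simpleReflection_zero_mul.simpleReflection_one_mul using 1 <;> ring

lemma exists_sign_eq_actsAs {s : ℤ} (hs : s = 1 ∨ s = -1) (r : ℤ) :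
    ∃ v : weylGroup, sign v = s ∧ ActsAs s r v.1 := by
  suffices h : ∃ v ∈ weylGroup, ActsAs s r v by
    obtain ⟨v, hv, h⟩ := h
    obtain ⟨r', hr'⟩ := exists_actsAs_sign ⟨v, hv⟩
    exact ⟨⟨v, hv⟩, hr'.unique h, h⟩
  rcases hs with rfl | rfl
  · exact exists_mem_weylGroup_actsAs_one r
  · obtain ⟨v, hv, h⟩ := exists_mem_weylGroup_actsAs_one (-r)
    refine ⟨_, weylGroup.mul_mem (simpleReflection_mem 1) hv, ?_⟩
    simpa using h.simpleReflection_one_mul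

end Weyl

/-! ### Maximizing the shifts -/

/-- The value of `S` for the weight `λ` of level `m'` which corresponds to the `r`-th element of
sign `s` of the Weyl group. Here `J = j + 1`, `J'' = j'' + 1` and `M` is the level of `Λ + ρ`. -/
def shiftValue (N : ℤ → ℤ) (M J J'' s r : ℤ) : ℤ :=
  N (s * J + 2 * M * r - J'') + s * J * r + M * r ^ 2

lemma levelWeight_add_wt_add_ρ (m m'' j'' : ℕ) (k n : ℤ) :
    levelWeight m k n + wt m'' j'' + ρ =
      levelWeight ((m + m'' : ℕ) + 2) (k + (j'' + 1)) n := by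
  apply weight_ext <;> simp [levelWeight, wt, ρ, Λ₀, α, δ]; ring

lemma wt_add_ρ (m j : ℕ) : wt m j + ρ = levelWeight (m + 2) (j + 1) 0 := by
  apply weight_ext <;> simp [levelWeight, wt, ρ, Λ₀, α, δ]

/-- The α-coordinate determines k from (s, r) and the δ-coordinate then determines S. The parity
assumption makes k ≡ j' mod 2 for every r, so no group element is excluded. -/
lemma shifts_eq {V : Type*} [AddCommGroup V] [Module ℂ V] [LieRingModule Affine V]
    {m' m'' j j' j'' : ℕ} {N : ℤ → ℤ} (hpar : (2 : ℤ) ∣ (j : ℤ) - j' - j'')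
    (hN : ∀ μ, μ ∈ maximalWeights V ↔ ∃ k : ℤ, 2 ∣ k - j' ∧ μ = levelWeight m' k (N k))
    {s : ℤ} (hs : s = 1 ∨ s = -1) :
    shifts V (wt (m' + m'') j) (wt m'' j'') s =
      Set.range (shiftValue N ((m' + m'' : ℕ) + 2) (j + 1) (j'' + 1) s) := by
  ext S
  constructor
  · rintro ⟨μ, hμ, v, rfl, hv⟩
    obtain ⟨k, -, rfl⟩ := (hN μ).1 hμ
    obtain ⟨r, hr⟩ := exists_actsAs_sign v
    rw [levelWeight_add_wt_add_ρ, wt_add_ρ, hr, levelWeight_add_smul_δ] at hv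
    obtain ⟨-, h1, h2⟩ := levelWeight_inj hv
    refine ⟨r, ?_⟩
    rw [shiftValue, ← h1, add_sub_cancel_right, h2]
    ring
  · rintro ⟨r, rfl⟩
    obtain ⟨v, hv, hr⟩ := exists_sign_eq_actsAs hs r
    refine ⟨_, (hN _).2 ⟨s * (j + 1) + 2 * ((m' + m'' : ℕ) + 2) * r - (j'' + 1), ?_, rfl⟩, v, hv, ?_⟩
    · rw [mul_assoc]
      rcases hs with rfl | rfl <;> omega
    · rw [levelWeight_add_wt_add_ρ, wt_add_ρ, hr, levelWeight_add_smul_δ, shiftValue]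
      congr 1 <;> ring

lemma le_of_forall_le_succ {g : ℤ → ℤ} {a : ℤ} (h : ∀ r < a, g r ≤ g (r + 1)) {r : ℤ}
    (hr : r ≤ a) : g r ≤ g a := by
  induction r, hr using Int.leInductionDown with
  | base => exact le_rfl
  | pred r hr ih =>
    have := h (r - 1) (by omega)
    rw [sub_add_cancel] at this
    exact this.trans ih

lemma le_of_forall_succ_le {g : ℤ → ℤ} {a : ℤ} (h : ∀ r, a ≤ r → g (r + 1) ≤ g r) {r : ℤ}
    (hr : a ≤ r) : g r ≤ g a := by
  induction r, hr using Int.leInduction with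
  | base => exact le_rfl
  | succ r hr ih => exact (h r hr).trans ih

section Maxima

variable {m' m'' j' M J J'' s : ℤ} {N : ℤ → ℤ} (h : IsDepthFunction m' j' N) (hm' : 0 < m')
  (hm'' : 0 < m'') (hj' : j' ≤ m') (hM : M = m' + m'' + 2) (hJ0 : 0 < J)
  (hJ : J < M) (hJ0'' : 0 < J'') (hJ'' : J'' ≤ m'' + 1) (hpar : 2 ∣ J - J'' - j')

-- With k the argument of `N` at r, periodicity rewrites the increment as N(k+2M) - N(k+2m') + m'' +
-- 2 + J''. For k ≤ -M the point k+2M is no farther from m' than k+2m', so monotonicity of 2N + k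
-- bounds the increment below by J''.
include h hm' hj' hm'' hM hJ0'' in
lemma shiftValue_le_succ {r : ℤ} (hr : 2 ∣ s * J + 2 * M * r - J'' - j')
    (hle : s * J + 2 * M * r - J'' ≤ -M) :
    shiftValue N M J J'' s r ≤ shiftValue N M J J'' s (r + 1) := by
  have e1 : s * J + 2 * M * (r + 1) - J'' = s * J + 2 * M * r - J'' + 2 * M := by ring
  have e2 : s * J * (r + 1) + M * (r + 1) ^ 2 =
      s * J * r + M * r ^ 2 + (s * J + 2 * M * r - J'') + J'' + M := by ring
  rw [shiftValue, shiftValue, e1, add_assoc, add_assoc, e2]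
  generalize s * J + 2 * M * r - J'' = k at *
  have h1 := h.add_period hr
  have h2 := (h.two_mul_add_le_of_abs_le hm' hj' (a := k + 2 * M) (b := k + 2 * m')
    (by omega) (by omega) (by grind)).1
  omega

-- Periodicity rewrites the increment as N(k+2m''+4) - N(k) + J'' - m'' - 2. The condition on k is
-- exactly |k| ≤ |k+2m''+4|, so both differences are nonpositive.
include h hm' hj' hm'' hM hJ'' in
lemma shiftValue_succ_le {r : ℤ} (hr : 2 ∣ s * J + 2 * M * r - J'' - j')
    (hle : -m'' - 2 ≤ s * J + 2 * M * r - J'') :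
    shiftValue N M J J'' s (r + 1) ≤ shiftValue N M J J'' s r := by
  have e1 : s * J + 2 * M * (r + 1) - J'' = s * J + 2 * M * r - J'' + 2 * M := by ring
  have e2 : s * J * (r + 1) + M * (r + 1) ^ 2 =
      s * J * r + M * r ^ 2 + (s * J + 2 * M * r - J'') + J'' + M := by ring
  rw [shiftValue, shiftValue, e1, add_assoc, add_assoc, e2]
  generalize s * J + 2 * M * r - J'' = k at *
  have h1 := h.add_period (k := k + 2 * m'' + 4) (by omega)
  have h2 := (h.le_of_abs_le hm' hj' (a := k) (b := k + 2 * m'' + 4)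
    (by omega) (by omega) (by grind)).1
  rw [show k + 2 * m'' + 4 + 2 * m' = k + 2 * M by rw [hM]; ring] at h1
  omega

-- Here k ≤ -M for r < 0 because J < M, and k ≥ J - J'' ≥ -m'' for r ≥ 0, so the two step lemmas
-- meet at r = 0.
include h hm' hj' hm'' hM hJ0 hJ hJ0'' hJ'' hpar in
lemma isGreatest_shiftValue_one :
    IsGreatest (Set.range (shiftValue N M J J'' 1)) (N (J - J'')) := by
  have h0 : shiftValue N M J J'' 1 0 = N (J - J'') := by simp [shiftValue]
  rw [← h0]
  refine ⟨⟨0, rfl⟩, ?_⟩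
  rintro _ ⟨r, rfl⟩
  have hdvd (r : ℤ) : 2 ∣ 1 * J + 2 * M * r - J'' - j' := by rw [mul_assoc]; omega
  rcases le_total r 0 with hr | hr
  · refine le_of_forall_le_succ (fun r hr => ?_) hr
    refine shiftValue_le_succ h hm' hm'' hj' hM hJ0'' (hdvd r) ?_
    nlinarith
  · refine le_of_forall_succ_le (fun r hr => ?_) hr
    refine shiftValue_succ_le h hm' hm'' hj' hM hJ'' (hdvd r) ?_
    nlinarith

-- The step from r = 0 to r = 1 starts at k = -J - J'', which need not lie in the range of either
-- step lemma; both endpoints therefore remain candidates.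
include h hm' hj' hm'' hM hJ0 hJ hJ0'' hJ'' hpar in
lemma isGreatest_shiftValue_neg_one :
    IsGreatest (Set.range (shiftValue N M J J'' (-1)))
      (max (N (-J - J'')) (N (2 * M - J - J'') + M - J)) := by
  have h0 : shiftValue N M J J'' (-1) 0 = N (-J - J'') := by simp [shiftValue]
  have h1 : shiftValue N M J J'' (-1) 1 = N (2 * M - J - J'') + M - J := by
    rw [shiftValue, show -1 * J + 2 * M * 1 - J'' = 2 * M - J - J'' by ring]
    ring
  rw [← h0, ← h1]
  constructor
  · rcases max_choice (shiftValue N M J J'' (-1) 0) (shiftValue N M J J'' (-1) 1) with h2 | h2 <;>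
      rw [h2] <;> exact ⟨_, rfl⟩
  rintro _ ⟨r, rfl⟩
  have hdvd (r : ℤ) : 2 ∣ -1 * J + 2 * M * r - J'' - j' := by rw [mul_assoc]; omega
  rcases le_or_gt r 0 with hr | hr
  · refine le_max_of_le_left (le_of_forall_le_succ (fun r hr => ?_) hr)
    refine shiftValue_le_succ h hm' hm'' hj' hM hJ0'' (hdvd r) ?_
    nlinarith
  · refine le_max_of_le_right (le_of_forall_succ_le (fun r hr => ?_) hr)
    refine shiftValue_succ_le h hm' hm'' hj' hM hJ'' (hdvd r) ?_
    nlinarith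

include h hm' hj' hM hJ0 hJ hJ0'' hJ'' hpar in
/-- If the maxima over both signs agree, then `J` is very small or very large. -/
lemma le_or_le_of_maxima_eq
    (heq : N (J - J'') = max (N (-J - J'')) (N (2 * M - J - J'') + M - J)) :
    J + J'' ≤ j' ∨ 2 * M - J - J'' ≤ 2 * m' - j' := by
  rcases max_choice (N (-J - J'')) (N (2 * M - J - J'') + M - J) with h2 | h2 <;> rw [h2] at heq
  · left
    by_contra hlt
    -- Both J and J'' are positive, so |J - J''| < J + J''.
    have := (h.le_of_abs_le hm' hj' (a := J - J'') (b := -J - J'') (by omega) (by omega)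
      (by grind)).2 (by grind) (by grind)
    omega
  · right
    by_contra hlt
    -- The equality says that 2N(k) + k agrees at J - J'' and 2M - J - J''; the second point is
    -- strictly farther from m' because J < M and J'' < m'' + 2.
    have := (h.two_mul_add_le_of_abs_le hm' hj' (a := J - J'') (b := 2 * M - J - J'')
      (by omega) (by omega) (by grind)).2 (by grind) (by grind)
    omega

end Maxima

end AffineSl2

end

/-! ### Comparison of the two orders of the factors -/

theorem mainTheorem12
    (m' m'' j j' j'' : ℕ) (hm' : 0 < m') (hm'' : 0 < m'')
    (hj' : j' ≤ m') (hj'' : j'' ≤ m'') (hj : j ≤ m' + m'')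
    (hpar : (2 : ℤ) ∣ (j : ℤ) - j' - j'')
    (V' : Type*) [AddCommGroup V'] [Module ℂ V'] [LieRingModule AffineSl2.Affine V']
    [LieModule ℂ AffineSl2.Affine V']
    (V'' : Type*) [AddCommGroup V''] [Module ℂ V''] [LieRingModule AffineSl2.Affine V'']
    [LieModule ℂ AffineSl2.Affine V'']
    (hV' : AffineSl2.IsIrreducibleHighestWeight V' (AffineSl2.wt m' j'))
    (hV'' : AffineSl2.IsIrreducibleHighestWeight V'' (AffineSl2.wt m'' j'')) :
    ∃ μ μbar ν νbar : ℤ,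
      IsGreatest (AffineSl2.shifts V' (AffineSl2.wt (m' + m'') j) (AffineSl2.wt m'' j'') 1) μ ∧
      IsGreatest (AffineSl2.shifts V' (AffineSl2.wt (m' + m'') j) (AffineSl2.wt m'' j'') (-1)) μbar ∧
      IsGreatest (AffineSl2.shifts V'' (AffineSl2.wt (m' + m'') j) (AffineSl2.wt m' j') 1) ν ∧
      IsGreatest (AffineSl2.shifts V'' (AffineSl2.wt (m' + m'') j) (AffineSl2.wt m' j') (-1)) νbar ∧
      (μ = μbar → ν ≠ νbar) := by
  obtain ⟨N', h', hN'⟩ := AffineSl2.exists_isDepthFunction hm' hj' hV'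
  obtain ⟨N'', h'', hN''⟩ := AffineSl2.exists_isDepthFunction hm'' hj'' hV''
  have hpar' : (2 : ℤ) ∣ (j : ℤ) - j'' - j' := by omega
  have hcomm : AffineSl2.wt (m' + m'') j = AffineSl2.wt (m'' + m') j := by rw [add_comm]
  have hM : (((m' + m'' : ℕ) : ℤ) + 2) = m' + m'' + 2 := by push_cast; ring
  have hM' : (((m'' + m' : ℕ) : ℤ) + 2) = m'' + m' + 2 := by push_cast; ring
  have a1 := AffineSl2.isGreatest_shiftValue_one h' (J := j + 1) (J'' := j'' + 1)
    (by omega) (by omega) (by omega) hM (by omega) (by omega) (by omega) (by omega)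
    (by omega)
  have a2 := AffineSl2.isGreatest_shiftValue_neg_one h' (J := j + 1) (J'' := j'' + 1)
    (by omega) (by omega) (by omega) hM (by omega) (by omega) (by omega) (by omega)
    (by omega)
  have b1 := AffineSl2.isGreatest_shiftValue_one h'' (J := j + 1) (J'' := j' + 1)
    (by omega) (by omega) (by omega) hM' (by omega) (by omega) (by omega) (by omega)
    (by omega)
  have b2 := AffineSl2.isGreatest_shiftValue_neg_one h'' (J := j + 1) (J'' := j' + 1)
    (by omega) (by omega) (by omega) hM' (by omega) (by omega) (by omega) (by omega)
    (by omega)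
  rw [← AffineSl2.shifts_eq hpar hN' (Or.inl rfl)] at a1
  rw [← AffineSl2.shifts_eq hpar hN' (Or.inr rfl)] at a2
  rw [← AffineSl2.shifts_eq hpar' hN'' (Or.inl rfl), ← hcomm] at b1
  rw [← AffineSl2.shifts_eq hpar' hN'' (Or.inr rfl), ← hcomm] at b2
  refine ⟨_, _, _, _, a1, a2, b1, b2, fun e1 e2 => ?_⟩
  have c1 := AffineSl2.le_or_le_of_maxima_eq h'
    (by omega) (by omega) hM (by omega) (by omega) (by omega) (by omega)
    (by omega) e1
  have c2 := AffineSl2.le_or_le_of_maxima_eq h''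
    (by omega) (by omega) hM' (by omega) (by omega) (by omega) (by omega)
    (by omega) e2
  -- The alternatives are j + j'' + 2 ≤ j' or 2m'' + 2 + j' ≤ j + j'', together with their
  -- exchanges. Equal types add up to contradict 0 ≤ j or j ≤ m' + m''; mixed types contradict j' ≤
  -- m' or j'' ≤ m''.
  omega
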